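/- Let $n\ge 1$ and $p=\mathfrak m-n\ge 0$ be integers, let $r>0$, and let $B_r'=\{y'\in\mathbb R^{n-1}:|y'|<r\}$. Points of the half space are written $y=(y',t)$ with $t=y^n>0$. For $\mathbf w=(w_1,\dots,w_p)$ put $g_{ij}[\mathbf w]=\delta_{ij}+\sum_{l=1}^{p}\partial_i w_l\,\partial_j w_l$ ($1\le i,j\le n$), let $(g^{ij}[\mathbf w])$ be the inverse matrix, and define $$\mathcal Q(\mathbf w)_s=\sum_{i,j=1}^n g^{ij}[\mathbf w]\,\partial_i\partial_j w_s-\frac{n}{t}\,\partial_t w_s,\qquad s=1,\dots,p .$$ Let $\varphi:B_r'\to\mathbb R^{p}$ be smooth. For every smooth $\mathbf c_{n+1,0}:B_r'\to\mathbb R^{p}$ there are smooth functions $\mathbf c_i$ $(2\le i\le n)$ and $\mathbf c_{i,j}$ $(i\ge n+1,\ 0\le j\le\lfloor (i-1)/n\rfloor,\ (i,j)\ne(n+1,0))$ from $B_r'$ to $\mathbb R^{p}$ such that $$\mathbf u=\varphi+\sum_{i=2}^{n}\mathbf c_i(y')\,t^i+\sum_{i=n+1}^{\infty}\ \sum_{j=0}^{\lfloor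 (i-1)/n\rfloor}\mathbf c_{i,j}(y')\,t^i(\log t)^j$$ solves $\mathcal Q(\mathbf u)=0$ formally, that is, as an identity of formal power series in $t$ whose coefficients are polynomials in $\log t$ (differentiated term by term, $\partial_t\log t=1/t$), at every $y'\in B_r'$. This formal series is unique: the given $\varphi$ and $\mathbf c_{n+1,0}$ determine all other coefficients on $B_r'$. Moreover $\mathbf c_i=\mathbf 0$ for every odd $i$ with $2\le i\le n$. Let $\mathbf T_k$ be the partial sum consisting of all terms of $\mathbf u$ with $i\le k$ (the term $\varphi$ having $i=0$). Then, as $t\to0^+$, $$\mathcal Q(\mathbf T_k)=O\!\left(t^{\,k-1}\,|\log t|^{\lfloor k/n\rfloor}\right)\quad\text{for all }k\ge n+1,\qquad \mathcal Q(\mathbf T_k)=O\!\left(t^{\,2\lfloor k/2\rfloor}\right)\quad\text{for all }0\le k\le n,$$ uniformly for $y'$ in compact subsets of $B_r'$. -/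

import Mathlib

open scoped ContDiff

noncomputable section

namespace MinSys

/-! Throughout `n = d + 1` is the dimension of the surface and `p = 𝔪 - n` its codimension.
Points of the half space are pairs `(y', t)` with `y'` in `ℝ^(n-1)` and `t = y^n`; the coordinate
directions are indexed by `Fin (d + 1)`, the last index being the `t`-direction. -/

/-- The tangential variables `y' = (y^1, …, y^(n-1))`. -/
abbrev Tan (d : ℕ) : Type := EuclideanSpace ℝ (Fin d)

/-- Tangential partial derivative `∂ f / ∂ y^β`. -/
def tanDeriv {d : ℕ} (β : Fin d) (f : Tan d → ℝ) (y : Tan d) : ℝ :=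
  lineDeriv ℝ f y (EuclideanSpace.single β 1)

/-! ### The minimal surface operator on functions -/

/-- The partial derivative in the coordinate `i` of a scalar function of `(y', t)`. -/
def pd {d : ℕ} (i : Fin (d + 1)) (f : Tan d → ℝ → ℝ) (y : Tan d) (t : ℝ) : ℝ :=
  Fin.lastCases (motive := fun _ => ℝ) (deriv (f y) t) (fun β => tanDeriv β (fun z => f z t) y) i

/-- The metric `g_ij[w] = δ_ij + ∑_l ∂_i w_l ∂_j w_l`. -/
def metric {d p : ℕ} (w : Tan d → ℝ → Fin p → ℝ) (y : Tan d) (t : ℝ) :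
    Matrix (Fin (d + 1)) (Fin (d + 1)) ℝ :=
  Matrix.of fun i j => (if i = j then 1 else 0) +
    ∑ l, pd i (fun z τ => w z τ l) y t * pd j (fun z τ => w z τ l) y t

/-- The operator `Q[w]_s = g^ij[w] ∂_i ∂_j w_s - (n / t) ∂_t w_s`. -/
def Q {d p : ℕ} (w : Tan d → ℝ → Fin p → ℝ) (y : Tan d) (t : ℝ) (s : Fin p) : ℝ :=
  (∑ i, ∑ j, (metric w y t)⁻¹ i j * pd i (pd j (fun z τ => w z τ s)) y t)
    - ((d + 1 : ℕ) : ℝ) / t * pd (Fin.last d) (fun z τ => w z τ s) y t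

/-! ### Formal series in `t` and `log t`

A coefficient family `a` gives, for each power `t^i` and each power `(log t)^j`, a function
`a i j` of `y'`. -/

/-- Largest power of `log t` that may accompany `t^i`, namely `⌊(i-1)/n⌋` for `i ≥ 1` and `0` for
`i = 0`. It is `0` for all `i ≤ n`. -/
def logDeg (d i : ℕ) : ℕ := (i - 1) / (d + 1)

/-- Formal power series in `t` whose coefficients are polynomials in the symbol `log t`
(`PowerSeries.X` is `t`, `Polynomial.X` is `log t`). -/
abbrev LogSeries : Type := PowerSeries (Polynomial ℝ)

/-- The formal series `∑_i ∑_{j ≤ logDeg i} a_ij(y') t^i (log t)^j` at the point `y'`. -/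
def ser {d : ℕ} (a : ℕ → ℕ → Tan d → ℝ) (y : Tan d) : LogSeries :=
  PowerSeries.mk fun i => ∑ j ∈ Finset.range (logDeg d i + 1),
    Polynomial.monomial j (a i j y)

/-- Formal `t`-derivative, determined by
`∂_t (t^(i+1) q(log t)) = t^i ((i+1) q(log t) + q'(log t))`, for series whose coefficient of `t^0`
does not involve `log t`. -/
def dt (f : LogSeries) : LogSeries :=
  PowerSeries.mk fun i =>
    ((i + 1 : ℕ) : Polynomial ℝ) * PowerSeries.coeff (i + 1) f
      + Polynomial.derivative (PowerSeries.coeff (i + 1) f)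

/-- Tangential derivative of a coefficient family, coefficient by coefficient. -/
def coefDeriv {d : ℕ} (β : Fin d) (a : ℕ → ℕ → Tan d → ℝ) : ℕ → ℕ → Tan d → ℝ :=
  fun i j => tanDeriv β (a i j)

/-- Formal first derivative `∂_i u` of the series with coefficients `a`. -/
def fd1 {d : ℕ} (i : Fin (d + 1)) (a : ℕ → ℕ → Tan d → ℝ) (y : Tan d) : LogSeries :=
  Fin.lastCases (motive := fun _ => LogSeries) (dt (ser a y))
    (fun β => ser (coefDeriv β a) y) i

/-- Formal second derivative `∂_i ∂_j u` of the series with coefficients `a`. -/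
def fd2 {d : ℕ} (i j : Fin (d + 1)) (a : ℕ → ℕ → Tan d → ℝ) (y : Tan d) : LogSeries :=
  Fin.lastCases (motive := fun _ => LogSeries) (dt (fd1 j a y))
    (fun β => fd1 j (coefDeriv β a) y) i

/-- The scalar coefficient family of the component `s`. -/
def comp {d p : ℕ} (c : ℕ → ℕ → Tan d → Fin p → ℝ) (s : Fin p) : ℕ → ℕ → Tan d → ℝ :=
  fun i j y => c i j y s

/-- The formal metric `g_ij[u] = δ_ij + ∑_l ∂_i u_l ∂_j u_l`. -/
def fmetric {d p : ℕ} (c : ℕ → ℕ → Tan d → Fin p → ℝ) (y : Tan d) :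
    Matrix (Fin (d + 1)) (Fin (d + 1)) LogSeries :=
  Matrix.of fun i j => (if i = j then 1 else 0) +
    ∑ l, fd1 i (comp c l) y * fd1 j (comp c l) y

/-- The series with coefficients `c` satisfies, at every `y'` with `|y'| < r`, the system
`g^ij ∂_i ∂_j u_s - (n / t) ∂_t u_s = 0` as an identity between formal series. The matrix `h` is
the inverse of the formal metric, and the equation has been multiplied by `t`. -/
def FormallySolves {d p : ℕ} (r : ℝ) (c : ℕ → ℕ → Tan d → Fin p → ℝ) : Prop :=
  ∀ y ∈ Metric.ball (0 : Tan d) r,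
    ∃ h : Matrix (Fin (d + 1)) (Fin (d + 1)) LogSeries,
      fmetric c y * h = 1 ∧
      ∀ s, PowerSeries.X * (∑ i, ∑ j, h i j * fd2 i j (comp c s) y)
        - ((d + 1 : ℕ) : LogSeries) * fd1 (Fin.last d) (comp c s) y = 0

/-- `c` is the family of coefficients of a formal series solution
`φ + ∑_{2 ≤ i ≤ n} c_i t^i + ∑_{i > n} ∑_{j ≤ ⌊(i-1)/n⌋} c_ij t^i (log t)^j`
with smooth coefficients on the ball `|y'| < r`; here `c_i = c i 0` for `i ≤ n`. Values `c i j`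
with `j > logDeg d i` do not belong to the series. -/
structure IsFormalSolution {d p : ℕ} (r : ℝ) (φ : Tan d → Fin p → ℝ)
    (c : ℕ → ℕ → Tan d → Fin p → ℝ) : Prop where
  smooth : ∀ i, ∀ j ≤ logDeg d i, ContDiffOn ℝ ∞ (c i j) (Metric.ball 0 r)
  zero : Set.EqOn (c 0 0) φ (Metric.ball 0 r)
  one : Set.EqOn (c 1 0) 0 (Metric.ball 0 r)
  solves : FormallySolves r c

/-- The partial sum `T_k`, consisting of all terms with `i ≤ k`. -/
def partialSum {d p : ℕ} (c : ℕ → ℕ → Tan d → Fin p → ℝ) (k : ℕ) (y : Tan d) (t : ℝ) :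
    Fin p → ℝ :=
  ∑ i ∈ Finset.range (k + 1), ∑ j ∈ Finset.range (logDeg d i + 1),
    (t ^ i * Real.log t ^ j) • c i j y

/-- `f(y', t) = O(ρ(t))` as `t → 0+`, uniformly for `y'` in compact subsets of the ball
`|y'| < r`. -/
def IsBigOLoc {d p : ℕ} (r : ℝ) (f : Tan d → ℝ → Fin p → ℝ) (ρ : ℝ → ℝ) : Prop :=
  ∀ K ⊆ Metric.ball (0 : Tan d) r, IsCompact K →
    ∃ C : ℝ, ∃ δ > 0, ∀ y ∈ K, ∀ t ∈ Set.Ioo (0 : ℝ) δ, ∀ s, |f y t s| ≤ C * ρ t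

end MinSys

end

/-!
Clear denominators in the system: multiplied by `t * det g` it becomes the polynomial expression
`clearedOp` in the first derivatives and in `t` times the second derivatives. This expression
commutes with ring homomorphisms, so one and the same formula is used for formal series at a point,
for families of formal series over `y'`, and for functions. Since `det g ≥ 1`
(`one_le_det_gram`), nothing is lost: the formal system is equivalent to the vanishing of
`clearedSeries` (`formallySolves_iff`), and `|Q|` is at most the cleared function divided by `t`
(`abs_Q_le`).

The formal system is triangular (`coeff_clearedSeries_sub`). Because `∂_t u = O(t)`, the last row of
the metric is trivial at `t = 0`, and the coefficient of `t ^ (i - 1)` depends on the coefficient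
`u_i` of `t ^ i`, a polynomial in `log t`, only through
`i (i - n - 1) u_i + (2 i - n - 1) u_i' + u_i''` times the determinant of the boundary metric. For
`i ≠ n + 1` this operator is invertible on polynomials of bounded degree (`logOp_logInv`). For
`i = n + 1` its kernel consists of the constants: the constant term is free, and a term with `log t`
solves the equation, because the right-hand side is free of logarithms there. Recursion on `i` gives
existence (`IsPartialSolution.exists_succ`) and uniqueness (`IsFormalSolution.agreeBelow`). The
bound on the powers of the logarithm holds because the series in which `t ^ i (log t) ^ j` occurs
only for `n j ≤ i` form a ring (`logSubring`), and smoothness in `y'` because the families with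
smooth coefficients form a ring closed under the formal derivatives (`smoothFam`).

The substitution `t ↦ -t` maps the cleared system of a series in even powers of `t` to its negative
(`coeff_clearedSeries_of_even`). Hence only even powers occur up to order `n`, and for `k ≤ n` the
cleared system of the partial sum `T_k` has only odd powers.

For the estimates, the pairs of a family of polynomials in `t` and `log t` and the function it
represents form a ring (`finFam`), and the formal derivatives represent the actual ones (`pd_mem_finFam`,
`pd_pd_mem_finFam`). So the cleared operator applied to `T_k` is a finite sum of terms
`a(y') t ^ i (log t) ^ j` whose coefficients below `t ^ k` vanish, and it is bounded term by term
(`exists_bound_of_mem_finFam`).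
-/

namespace MinSys

/-! ### The operator with cleared denominators over a commutative ring -/

section ClearedOp

variable {R S : Type*} [CommRing R] [CommRing S] {d m p : ℕ}

/-- The matrix `δ_ij + ∑_l D_il D_jl` built from an array `D` of first derivatives. -/
def gram (D : Fin m → Fin p → R) : Matrix (Fin m) (Fin m) R :=
  Matrix.of fun i j => (if i = j then 1 else 0) + ∑ l, D i l * D j l

/-- The minimal surface operator multiplied by `t * det g`, as a polynomial expression in the first
derivatives `D` and in `H`, which stands for `t` times the second derivatives. It makes sense over
every commutative ring, which allows it to be used for formal series, for families of formal series
and for functions alike. -/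
def clearedOp (D : Fin (d + 1) → Fin p → R) (H : Fin (d + 1) → Fin (d + 1) → Fin p → R)
    (s : Fin p) : R :=
  ∑ i, ∑ j, (gram D).adjugate i j * H i j s
    - ((d + 1 : ℕ) : R) * (gram D).det * D (Fin.last d) s

lemma gram_map (f : R →+* S) (D : Fin m → Fin p → R) :
    f.mapMatrix (gram D) = gram fun i l => f (D i l) := by
  ext i j
  simp only [gram, RingHom.mapMatrix_apply, Matrix.map_apply, Matrix.of_apply, map_add, map_sum,
    map_mul]
  split_ifs <;> simp

lemma map_det_gram (f : R →+* S) (D : Fin m → Fin p → R) :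
    f (gram D).det = (gram fun i l => f (D i l)).det := by
  rw [RingHom.map_det, gram_map]

lemma map_adjugate_gram (f : R →+* S) (D : Fin m → Fin p → R) (i j : Fin m) :
    f ((gram D).adjugate i j) = (gram fun i l => f (D i l)).adjugate i j := by
  rw [← gram_map, ← RingHom.map_adjugate]
  rfl

lemma map_clearedOp (f : R →+* S) (D : Fin (d + 1) → Fin p → R)
    (H : Fin (d + 1) → Fin (d + 1) → Fin p → R) (s : Fin p) :
    f (clearedOp D H s) = clearedOp (fun i l => f (D i l)) (fun i j l => f (H i j l)) s := by
  simp only [clearedOp, map_sub, map_sum, map_mul, map_adjugate_gram, map_det_gram, map_natCast]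

lemma clearedOp_apply {Y : Type*} (D : Fin (d + 1) → Fin p → Y → R)
    (H : Fin (d + 1) → Fin (d + 1) → Fin p → Y → R) (s : Fin p) (y : Y) :
    clearedOp D H s y = clearedOp (fun i l => D i l y) (fun i j l => H i j l y) s := by
  have := map_clearedOp (Pi.evalRingHom (fun _ : Y => R) y) D H s
  simpa only [Pi.evalRingHom_apply] using this

lemma det_gram_apply {Y : Type*} (D : Fin m → Fin p → Y → R) (y : Y) :
    (gram D).det y = (gram fun i l => D i l y).det := by
  have := map_det_gram (Pi.evalRingHom (fun _ : Y => R) y) D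
  simpa only [Pi.evalRingHom_apply] using this

lemma det_gram_mem (A : Subring R) {D : Fin m → Fin p → R} (hD : ∀ i l, D i l ∈ A) :
    (gram D).det ∈ A := by
  have := map_det_gram A.subtype (fun i l => (⟨D i l, hD i l⟩ : A))
  simp only [Subring.subtype_apply] at this
  rw [← this]
  exact SetLike.coe_mem _

lemma clearedOp_mem (A : Subring R) {D : Fin (d + 1) → Fin p → R}
    {H : Fin (d + 1) → Fin (d + 1) → Fin p → R} (hD : ∀ i l, D i l ∈ A)
    (hH : ∀ i j l, H i j l ∈ A) (s : Fin p) : clearedOp D H s ∈ A := by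
  have := map_clearedOp A.subtype (fun i l => (⟨D i l, hD i l⟩ : A))
    (fun i j l => (⟨H i j l, hH i j l⟩ : A)) s
  simp only [Subring.subtype_apply] at this
  rw [← this]
  exact SetLike.coe_mem _

lemma det_gram_sub_mem (I : Ideal R) {D D' : Fin m → Fin p → R}
    (h : ∀ i l, D i l - D' i l ∈ I) : (gram D).det - (gram D').det ∈ I := by
  rw [← Ideal.Quotient.mk_eq_mk_iff_sub_mem, map_det_gram, map_det_gram]
  simp only [(Ideal.Quotient.mk_eq_mk_iff_sub_mem _ _).2 (h _ _)]

lemma adjugate_gram_sub_mem (I : Ideal R) {D D' : Fin m → Fin p → R}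
    (h : ∀ i l, D i l - D' i l ∈ I) (i j : Fin m) :
    (gram D).adjugate i j - (gram D').adjugate i j ∈ I := by
  rw [← Ideal.Quotient.mk_eq_mk_iff_sub_mem, map_adjugate_gram, map_adjugate_gram]
  simp only [(Ideal.Quotient.mk_eq_mk_iff_sub_mem _ _).2 (h _ _)]

lemma gram_transpose (D : Fin m → Fin p → R) : (gram D).transpose = gram D := by
  ext i j
  simp only [gram, Matrix.transpose_apply, Matrix.of_apply, eq_comm, mul_comm]

lemma adjugate_gram_comm (D : Fin m → Fin p → R) (i j : Fin m) :
    (gram D).adjugate i j = (gram D).adjugate j i := by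
  conv_lhs => rw [← gram_transpose, ← Matrix.adjugate_transpose]
  rfl

/-- If the derivatives of index `k` vanish, then the row of index `k` of the metric is that of the
identity matrix, and the cofactor at `k` is the determinant. -/
lemma adjugate_gram_self {D : Fin m → Fin p → R} {k : Fin m} (h : ∀ l, D k l = 0) :
    (gram D).adjugate k k = (gram D).det := by
  have := congrFun (congrFun (Matrix.mul_adjugate (gram D)) k) k
  simpa [Matrix.mul_apply, gram, h] using this

/-- A change of sign of some of the variables (`e i = -1`), the last one among them,
reverses the sign of the operator. -/
lemma clearedOp_sign {D : Fin (d + 1) → Fin p → R} {H : Fin (d + 1) → Fin (d + 1) → Fin p → R}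
    {e : Fin (d + 1) → R} (he : ∀ i, e i * e i = 1) (hl : e (Fin.last d) = -1) (s : Fin p) :
    clearedOp (fun i l => e i * D i l) (fun i j l => -(e i * e j * H i j l)) s
      = -clearedOp D H s := by
  set J := Matrix.diagonal e with hJ
  have hJJ : J * J = 1 := by
    rw [hJ, Matrix.diagonal_mul_diagonal, ← Matrix.diagonal_one]
    congr 1
    funext i
    exact he i
  have hdd : J.det * J.det = 1 := by rw [← Matrix.det_mul, hJJ, Matrix.det_one]
  have hadj : J.adjugate = J.det • J := by
    have := congrArg (· * J) (Matrix.adjugate_mul J)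
    simpa [mul_assoc, hJJ] using this
  have hg : gram (fun i l => e i * D i l) = J * gram D * J := by
    ext i j
    rw [hJ, Matrix.mul_diagonal, Matrix.diagonal_mul]
    simp only [gram, Matrix.of_apply, mul_add, add_mul, Finset.mul_sum, Finset.sum_mul]
    congr 1
    · split_ifs with h
      · subst h
        simp [he]
      · simp
    · exact Finset.sum_congr rfl fun l _ => by ring
  have hdet : (gram (fun i l => e i * D i l)).det = (gram D).det := by
    rw [hg, Matrix.det_mul, Matrix.det_mul]
    linear_combination (gram D).det * hdd
  have hadj' : ∀ i j, (gram (fun i l => e i * D i l)).adjugate i j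
      = e i * e j * (gram D).adjugate i j := by
    intro i j
    rw [hg, Matrix.adjugate_mul_distrib, Matrix.adjugate_mul_distrib, hadj]
    simp only [Matrix.smul_mul, Matrix.mul_smul, Matrix.smul_apply, smul_eq_mul]
    rw [← mul_assoc J, hJ, Matrix.mul_diagonal, Matrix.diagonal_mul, ← hJ]
    linear_combination e i * e j * (gram D).adjugate i j * hdd
  simp only [clearedOp, hdet, hadj', hl]
  rw [neg_sub, sub_eq_add_neg, add_comm, sub_eq_add_neg, ← Finset.sum_neg_distrib]
  congr 1
  · ring
  · refine Finset.sum_congr rfl fun i _ => ?_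
    rw [← Finset.sum_neg_distrib]
    refine Finset.sum_congr rfl fun j _ => ?_
    linear_combination (-(gram D).adjugate i j * H i j s) * (e i * e i * he j + he i)

end ClearedOp

/-- By the matrix determinant lemma, adding a rank-one matrix `v vᵀ` to a positive definite matrix
does not decrease its determinant. -/
lemma one_le_det_gram {m p : ℕ} (D : Fin m → Fin p → ℝ) : 1 ≤ (gram D).det := by
  have key : ∀ T : Finset (Fin p),
      ((1 : Matrix (Fin m) (Fin m) ℝ)
        + ∑ l ∈ T, Matrix.vecMulVec (fun i => D i l) (fun i => D i l)).PosDef ∧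
      1 ≤ ((1 : Matrix (Fin m) (Fin m) ℝ)
        + ∑ l ∈ T, Matrix.vecMulVec (fun i => D i l) (fun i => D i l)).det := by
    intro T
    induction T using Finset.induction_on with
    | empty => simpa using Matrix.PosDef.one
    | insert a T ha ih =>
      obtain ⟨h1, h2⟩ := ih
      rw [Finset.sum_insert ha, add_comm (Matrix.vecMulVec _ _), ← add_assoc]
      set A := (1 : Matrix (Fin m) (Fin m) ℝ)
        + ∑ l ∈ T, Matrix.vecMulVec (fun i => D i l) (fun i => D i l)
      have hps := Matrix.posSemidef_vecMulVec_self_star (fun i => D i a)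
      rw [star_trivial] at hps
      refine ⟨h1.add_posSemidef hps, ?_⟩
      rw [Matrix.vecMulVec_eq Unit,
        Matrix.det_add_replicateCol_mul_replicateRow (isUnit_iff_ne_zero.2 (by linarith))]
      have hq : 0 ≤ (Matrix.replicateRow Unit (fun i => D i a) * A⁻¹
          * Matrix.replicateCol Unit (fun i => D i a)) () () := by
        have := h1.inv.posSemidef.dotProduct_mulVec_nonneg (fun i => D i a)
        rw [star_trivial, Matrix.dotProduct_mulVec] at this
        exact this
      rw [Matrix.det_unique (n := Unit)]
      simp only [Matrix.add_apply, Matrix.one_apply_eq]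
      exact le_trans h2 (le_mul_of_one_le_right (by linarith) (le_add_of_nonneg_right hq))
  have h := (key Finset.univ).2
  convert h using 2
  ext i j
  simp [gram, Matrix.one_apply, Matrix.sum_apply, Matrix.vecMulVec_apply]

variable {d p : ℕ} {r : ℝ}

/-! ### Tangential derivatives on the ball -/

lemma tanDeriv_congr {f g : Tan d → ℝ} (h : Set.EqOn f g (Metric.ball 0 r)) (β : Fin d) :
    Set.EqOn (tanDeriv β f) (tanDeriv β g) (Metric.ball 0 r) := by
  intro y hy
  exact Filter.EventuallyEq.lineDeriv_eq (h.eventuallyEq_of_mem (Metric.isOpen_ball.mem_nhds hy))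

lemma tanDeriv_zero (β : Fin d) : tanDeriv β (0 : Tan d → ℝ) = 0 := by
  funext y
  simp [tanDeriv, lineDeriv]

lemma tanDeriv_eqOn_zero {f : Tan d → ℝ} (h : Set.EqOn f 0 (Metric.ball 0 r)) (β : Fin d) :
    Set.EqOn (tanDeriv β f) 0 (Metric.ball 0 r) := by
  have := tanDeriv_congr h β
  rwa [tanDeriv_zero] at this

lemma contDiffOn_tanDeriv {f : Tan d → ℝ} (h : ContDiffOn ℝ ∞ f (Metric.ball 0 r)) (β : Fin d) :
    ContDiffOn ℝ ∞ (tanDeriv β f) (Metric.ball 0 r) := by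
  have h1 : ContDiffOn ℝ ∞ (fun y => fderiv ℝ f y (EuclideanSpace.single β 1))
      (Metric.ball 0 r) :=
    (h.fderiv_of_isOpen Metric.isOpen_ball (by simp)).clm_apply contDiffOn_const
  refine h1.congr fun y hy => ?_
  have hd : DifferentiableAt ℝ f y :=
    (h.contDiffAt (Metric.isOpen_ball.mem_nhds hy)).differentiableAt (by simp)
  exact hd.lineDeriv_eq_fderiv

/-! ### Formal derivatives -/

lemma coeff_ser (a : ℕ → ℕ → Tan d → ℝ) (y : Tan d) (i j : ℕ) :
    (PowerSeries.coeff i (ser a y)).coeff j = if j ≤ logDeg d i then a i j y else 0 := by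
  simp [ser, Polynomial.finsetSum_coeff, Polynomial.coeff_monomial]

lemma coeff_dt (f : LogSeries) (i : ℕ) : PowerSeries.coeff i (dt f)
    = Polynomial.C ((i : ℝ) + 1) * PowerSeries.coeff (i + 1) f
      + Polynomial.derivative (PowerSeries.coeff (i + 1) f) := by
  simp [dt]

lemma coeff_coeff_dt (f : LogSeries) (i j : ℕ) : (PowerSeries.coeff i (dt f)).coeff j
    = ((i : ℝ) + 1) * (PowerSeries.coeff (i + 1) f).coeff j
      + (PowerSeries.coeff (i + 1) f).coeff (j + 1) * ((j : ℝ) + 1) := by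
  rw [coeff_dt, Polynomial.coeff_add, Polynomial.coeff_C_mul, Polynomial.coeff_derivative]

lemma dt_sub (f g : LogSeries) : dt (f - g) = dt f - dt g := by
  ext i : 1
  simp only [coeff_dt, map_sub]
  ring

lemma dt_neg (f : LogSeries) : dt (-f) = -dt f := by
  ext i : 1
  simp only [coeff_dt, map_neg]
  ring

lemma X_pow_dvd_dt {k : ℕ} {f : LogSeries} (h : PowerSeries.X ^ (k + 1) ∣ f) :
    PowerSeries.X ^ k ∣ dt f := by
  rw [PowerSeries.X_pow_dvd_iff] at h ⊢
  intro i hi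
  rw [coeff_dt, h (i + 1) (by omega)]
  simp

lemma coeff_mul_of_X_pow_dvd {k : ℕ} (f : LogSeries) {g : LogSeries}
    (h : PowerSeries.X ^ k ∣ g) :
    PowerSeries.coeff k (f * g) = PowerSeries.coeff 0 f * PowerSeries.coeff k g := by
  obtain ⟨g, rfl⟩ := h
  rw [mul_left_comm, PowerSeries.coeff_X_pow_mul', PowerSeries.coeff_X_pow_mul']
  simp

@[simp] lemma fd1_last (a : ℕ → ℕ → Tan d → ℝ) (y : Tan d) :
    fd1 (Fin.last d) a y = dt (ser a y) := by simp [fd1]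

@[simp] lemma fd1_castSucc (β : Fin d) (a : ℕ → ℕ → Tan d → ℝ) (y : Tan d) :
    fd1 β.castSucc a y = ser (coefDeriv β a) y := by simp [fd1]

@[simp] lemma fd2_last (j : Fin (d + 1)) (a : ℕ → ℕ → Tan d → ℝ) (y : Tan d) :
    fd2 (Fin.last d) j a y = dt (fd1 j a y) := by simp [fd2]

@[simp] lemma fd2_castSucc (β : Fin d) (j : Fin (d + 1)) (a : ℕ → ℕ → Tan d → ℝ) (y : Tan d) :
    fd2 β.castSucc j a y = fd1 j (coefDeriv β a) y := by simp [fd2]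

/-! ### The formal system with cleared denominators -/

/-- The left-hand side of the formal system, multiplied by `t * det g`. -/
noncomputable def clearedSeries (c : ℕ → ℕ → Tan d → Fin p → ℝ) (y : Tan d) (s : Fin p) :
    LogSeries :=
  clearedOp (fun i l => fd1 i (comp c l) y)
    (fun i j l => PowerSeries.X * fd2 i j (comp c l) y) s

/-- The determinant of the metric on the boundary `t = 0`. -/
noncomputable def boundaryDet (c : ℕ → ℕ → Tan d → Fin p → ℝ) (y : Tan d) : ℝ :=
  (gram fun (i : Fin (d + 1)) (l : Fin p) => Fin.lastCases (motive := fun _ => ℝ)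
    (comp c l 1 0 y) (fun β => tanDeriv β (comp c l 0 0) y) i).det

lemma boundaryDet_pos (c : ℕ → ℕ → Tan d → Fin p → ℝ) (y : Tan d) : 0 < boundaryDet c y :=
  zero_lt_one.trans_le (one_le_det_gram _)

lemma coeff_zero_ser (a : ℕ → ℕ → Tan d → ℝ) (y : Tan d) :
    PowerSeries.coeff 0 (ser a y) = Polynomial.C (a 0 0 y) := by
  simp [ser, logDeg]

lemma coeff_zero_dt_ser (a : ℕ → ℕ → Tan d → ℝ) (y : Tan d) :
    PowerSeries.coeff 0 (dt (ser a y)) = Polynomial.C (a 1 0 y) := by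
  rw [coeff_dt]
  simp [ser, logDeg]

lemma coeff_zero_det (c : ℕ → ℕ → Tan d → Fin p → ℝ) (y : Tan d) :
    PowerSeries.coeff 0 (gram fun i l => fd1 i (comp c l) y).det
      = Polynomial.C (boundaryDet c y) := by
  rw [boundaryDet, map_det_gram, PowerSeries.coeff_zero_eq_constantCoeff_apply, map_det_gram]
  congr 2
  funext i l
  rw [← PowerSeries.coeff_zero_eq_constantCoeff_apply]
  refine Fin.lastCases ?_ (fun β => ?_) i
  · rw [fd1_last, coeff_zero_dt_ser, Fin.lastCases_last]
  · rw [fd1_castSucc, coeff_zero_ser, Fin.lastCases_castSucc]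
    rfl

lemma isUnit_det_fmetric (c : ℕ → ℕ → Tan d → Fin p → ℝ) (y : Tan d) :
    IsUnit (fmetric c y).det := by
  rw [PowerSeries.isUnit_iff_constantCoeff, ← PowerSeries.coeff_zero_eq_constantCoeff_apply]
  change IsUnit (PowerSeries.coeff 0 (gram fun i l => fd1 i (comp c l) y).det)
  rw [coeff_zero_det, Polynomial.isUnit_C]
  exact isUnit_iff_ne_zero.2 (boundaryDet_pos c y).ne'

/-- The formal system is equivalent to the vanishing of the cleared operator, since the determinant
of the formal metric is invertible. -/
lemma formallySolves_iff (c : ℕ → ℕ → Tan d → Fin p → ℝ) :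
    FormallySolves r c ↔ ∀ y ∈ Metric.ball (0 : Tan d) r, ∀ s, clearedSeries c y s = 0 := by
  have key : ∀ (y : Tan d) (h : Matrix (Fin (d + 1)) (Fin (d + 1)) LogSeries) (s : Fin p),
      fmetric c y * h = 1 → clearedSeries c y s = (fmetric c y).det *
        (PowerSeries.X * (∑ i, ∑ j, h i j * fd2 i j (comp c s) y)
        - ((d + 1 : ℕ) : LogSeries) * fd1 (Fin.last d) (comp c s) y) := by
    intro y h s hh
    have hadj : (fmetric c y).adjugate = (fmetric c y).det • h := by
      rw [← mul_one (fmetric c y).adjugate, ← hh, ← mul_assoc, Matrix.adjugate_mul,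
        Matrix.smul_mul, one_mul]
    have hG : (gram fun i l => fd1 i (comp c l) y) = fmetric c y := rfl
    rw [clearedSeries, clearedOp, hG, hadj, mul_sub, Finset.mul_sum, Finset.mul_sum]
    congr 1
    · refine Finset.sum_congr rfl fun i _ => ?_
      rw [Finset.mul_sum, Finset.mul_sum]
      refine Finset.sum_congr rfl fun j _ => ?_
      rw [Matrix.smul_apply, smul_eq_mul]
      ring
    · ring
  constructor
  · intro H y hy s
    obtain ⟨h, h1, h2⟩ := H y hy
    rw [key y h s h1, h2 s, mul_zero]
  · intro H y hy
    have hu := isUnit_det_fmetric c y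
    refine ⟨(fmetric c y)⁻¹, Matrix.mul_nonsing_inv _ hu, fun s => ?_⟩
    have := key y _ s (Matrix.mul_nonsing_inv _ hu)
    rw [H y hy s] at this
    exact hu.mul_right_eq_zero.1 this.symm

/-! ### Dependence of the coefficients of the system on those of the series -/

/-- Two coefficient families agree on the ball at all powers of `t` below `t ^ m`. -/
def AgreeBelow (r : ℝ) (m : ℕ) (a a' : ℕ → ℕ → Tan d → ℝ) : Prop :=
  ∀ i < m, ∀ j ≤ logDeg d i, Set.EqOn (a i j) (a' i j) (Metric.ball 0 r)

lemma AgreeBelow.coefDeriv {m : ℕ} {a a' : ℕ → ℕ → Tan d → ℝ} (h : AgreeBelow r m a a')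
    (β : Fin d) : AgreeBelow r m (coefDeriv β a) (coefDeriv β a') :=
  fun i hi j hj => tanDeriv_congr (h i hi j hj) β

lemma AgreeBelow.mono {m k : ℕ} {a a' : ℕ → ℕ → Tan d → ℝ} (h : AgreeBelow r m a a')
    (hk : k ≤ m) : AgreeBelow r k a a' := fun i hi => h i (hi.trans_le hk)

lemma AgreeBelow.coeff_ser_eq {m i : ℕ} {a a' : ℕ → ℕ → Tan d → ℝ} (h : AgreeBelow r m a a')
    (hi : i < m) {y : Tan d} (hy : y ∈ Metric.ball 0 r) :
    PowerSeries.coeff i (ser a y) = PowerSeries.coeff i (ser a' y) := by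
  ext j
  rw [coeff_ser, coeff_ser]
  split_ifs with hj
  · exact h i hi j hj hy
  · rfl

lemma AgreeBelow.dvd_ser {m : ℕ} {a a' : ℕ → ℕ → Tan d → ℝ} (h : AgreeBelow r m a a')
    {y : Tan d} (hy : y ∈ Metric.ball 0 r) :
    PowerSeries.X ^ m ∣ ser a y - ser a' y := by
  rw [PowerSeries.X_pow_dvd_iff]
  intro i hi
  rw [map_sub, h.coeff_ser_eq hi hy, sub_self]

lemma AgreeBelow.dvd_dt_ser {m : ℕ} {a a' : ℕ → ℕ → Tan d → ℝ} (h : AgreeBelow r (m + 1) a a')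
    {y : Tan d} (hy : y ∈ Metric.ball 0 r) :
    PowerSeries.X ^ m ∣ dt (ser a y) - dt (ser a' y) := by
  rw [← dt_sub]
  exact X_pow_dvd_dt (h.dvd_ser hy)

lemma AgreeBelow.dvd_fd1 {m : ℕ} {a a' : ℕ → ℕ → Tan d → ℝ} (h : AgreeBelow r (m + 1) a a')
    {y : Tan d} (hy : y ∈ Metric.ball 0 r) (i : Fin (d + 1)) :
    PowerSeries.X ^ m ∣ fd1 i a y - fd1 i a' y := by
  refine Fin.lastCases ?_ (fun β => ?_) i
  · simpa using h.dvd_dt_ser hy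
  · simpa using (pow_dvd_pow _ (Nat.le_succ m)).trans ((h.coefDeriv β).dvd_ser hy)

/-- The operator `a + b ∂ + ∂ ^ 2` on polynomials in `log t`. -/
noncomputable def logOp (a b : ℝ) (q : Polynomial ℝ) : Polynomial ℝ :=
  Polynomial.C a * q + Polynomial.C b * Polynomial.derivative q
    + Polynomial.derivative (Polynomial.derivative q)

/-- The triangular structure of the system: if two series agree below `t ^ (k + 2)`, then the
coefficients of `t ^ (k + 1)` in the cleared systems differ by the indicial operator of
`t ∂_t ^ 2 - n ∂_t` at the exponent `k + 2`, applied to the difference of the coefficients of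
`t ^ (k + 2)`. As `∂_t u = O(t)`, the metric at `t = 0` has trivial last row, and all other
contributions have higher order. -/
lemma coeff_clearedSeries_sub {k : ℕ} {c c' : ℕ → ℕ → Tan d → Fin p → ℝ}
    (h : ∀ s, AgreeBelow r (k + 2) (comp c s) (comp c' s))
    (h1 : Set.EqOn (c 1 0) 0 (Metric.ball 0 r)) {y : Tan d} (hy : y ∈ Metric.ball 0 r)
    (s : Fin p) :
    PowerSeries.coeff (k + 1) (clearedSeries c y s)
        - PowerSeries.coeff (k + 1) (clearedSeries c' y s)
      = Polynomial.C (boundaryDet c' y) * logOp (((k : ℝ) + 2) * (k - d)) (2 * k + 2 - d)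
          (PowerSeries.coeff (k + 2) (ser (comp c s) y)
            - PowerSeries.coeff (k + 2) (ser (comp c' s) y)) := by
  set D : Fin (d + 1) → Fin p → LogSeries := fun i l => fd1 i (comp c l) y with hD
  set D' : Fin (d + 1) → Fin p → LogSeries := fun i l => fd1 i (comp c' l) y with hD'
  set δ : LogSeries := ser (comp c s) y - ser (comp c' s) y with hδ
  have hDD : ∀ i l, D i l - D' i l ∈ Ideal.span {(PowerSeries.X : LogSeries) ^ (k + 1)} :=
    fun i l => Ideal.mem_span_singleton.2 ((h l).dvd_fd1 hy i)
  have hA := fun i j => Ideal.mem_span_singleton.1 (adjugate_gram_sub_mem _ hDD i j)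
  have hdet := Ideal.mem_span_singleton.1 (det_gram_sub_mem _ hDD)
  have hH : ∀ i j, PowerSeries.X ^ (k + 2) ∣ PowerSeries.X * fd2 i j (comp c s) y
      - PowerSeries.X * fd2 i j (comp c' s) y
      - (if i = Fin.last d ∧ j = Fin.last d then PowerSeries.X * dt (dt δ) else 0) := by
    intro i j
    rw [← mul_sub]
    refine Fin.lastCases ?_ (fun β => ?_) i
    · refine Fin.lastCases ?_ (fun γ => ?_) j
      · simp [hδ, dt_sub]
      · have := ((h s).coefDeriv γ).dvd_dt_ser hy
        simpa [pow_succ' _ (k + 1), Fin.castSucc_ne_last] using mul_dvd_mul_left _ this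
    · have := ((h s).coefDeriv β).dvd_fd1 hy j
      simpa [pow_succ' _ (k + 1), Fin.castSucc_ne_last] using mul_dvd_mul_left _ this
  have hXD : PowerSeries.X ∣ D (Fin.last d) s := by
    rw [PowerSeries.X_dvd_iff, ← PowerSeries.coeff_zero_eq_constantCoeff_apply, hD]
    simp only [fd1_last]
    rw [coeff_zero_dt_ser]
    have := congrFun (h1 hy) s
    simpa [comp] using this
  set M : LogSeries := (gram D').adjugate (Fin.last d) (Fin.last d) * (PowerSeries.X * dt (dt δ))
    - ((d + 1 : ℕ) : LogSeries) * ((gram D').det * dt δ) with hM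
  have hmain : PowerSeries.X ^ (k + 2) ∣ clearedSeries c y s - clearedSeries c' y s - M := by
    have e1 : (gram D').adjugate (Fin.last d) (Fin.last d) * (PowerSeries.X * dt (dt δ))
        = ∑ i, ∑ j, (gram D').adjugate i j *
          (if i = Fin.last d ∧ j = Fin.last d then PowerSeries.X * dt (dt δ) else 0) := by
      simp only [ite_and, mul_ite, mul_zero, Finset.sum_ite_irrel, Finset.sum_const_zero,
        Finset.sum_ite_eq', Finset.mem_univ, if_true]
    have e2 : clearedSeries c y s - clearedSeries c' y s - M
        = ∑ i, ∑ j, (((gram D).adjugate i j - (gram D').adjugate i j)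
              * (PowerSeries.X * fd2 i j (comp c s) y)
            + (gram D').adjugate i j * (PowerSeries.X * fd2 i j (comp c s) y
              - PowerSeries.X * fd2 i j (comp c' s) y
              - (if i = Fin.last d ∧ j = Fin.last d then PowerSeries.X * dt (dt δ) else 0)))
          - ((d + 1 : ℕ) : LogSeries) * (((gram D).det - (gram D').det) * D (Fin.last d) s) := by
      have e3 : dt δ = D (Fin.last d) s - D' (Fin.last d) s := by
        simp [hD, hD', hδ, dt_sub]
      rw [hM, e1, e3]
      simp only [clearedSeries, clearedOp, mul_sub, sub_mul, Finset.sum_add_distrib,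
        Finset.sum_sub_distrib]
      ring
    rw [e2]
    refine dvd_sub (Finset.dvd_sum fun i _ => Finset.dvd_sum fun j _ => dvd_add ?_ ?_) ?_
    · rw [pow_succ]
      exact mul_dvd_mul (hA i j) (dvd_mul_right _ _)
    · exact (hH i j).mul_left _
    · rw [pow_succ]
      exact (mul_dvd_mul hdet hXD).mul_left _
  have hc := (PowerSeries.X_pow_dvd_iff.1 hmain) (k + 1) (by omega)
  rw [map_sub, map_sub, sub_eq_zero] at hc
  rw [hc]
  have hδd : PowerSeries.X ^ (k + 2) ∣ δ := (h s).dvd_ser hy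
  have hδ1 : PowerSeries.X ^ (k + 1) ∣ dt δ := X_pow_dvd_dt hδd
  have hδ2 : PowerSeries.X ^ (k + 1) ∣ PowerSeries.X * dt (dt δ) := by
    rw [pow_succ']
    exact mul_dvd_mul_left _ (X_pow_dvd_dt hδ1)
  have hdet0 : PowerSeries.coeff 0 (gram D').det = Polynomial.C (boundaryDet c' y) :=
    coeff_zero_det c' y
  have hadj0 : PowerSeries.coeff 0 ((gram D').adjugate (Fin.last d) (Fin.last d))
      = Polynomial.C (boundaryDet c' y) := by
    rw [← hdet0, PowerSeries.coeff_zero_eq_constantCoeff_apply,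
      PowerSeries.coeff_zero_eq_constantCoeff_apply, map_adjugate_gram, map_det_gram,
      adjugate_gram_self]
    intro l
    rw [← PowerSeries.coeff_zero_eq_constantCoeff_apply, hD']
    simp only [fd1_last]
    rw [coeff_zero_dt_ser, ← h l 1 (by omega) 0 (Nat.zero_le _) hy]
    have := congrFun (h1 hy) l
    simpa [comp] using this
  have hcast : ((d + 1 : ℕ) : LogSeries) = PowerSeries.C (Polynomial.C ((d : ℝ) + 1)) := by
    simp
  rw [hM, map_sub, hcast, PowerSeries.coeff_C_mul, coeff_mul_of_X_pow_dvd _ hδ2,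
    coeff_mul_of_X_pow_dvd _ hδ1, hadj0, hdet0, PowerSeries.coeff_succ_X_mul, ← map_sub, ← hδ,
    coeff_dt, coeff_dt, logOp]
  simp only [Polynomial.derivative_mul, Polynomial.derivative_natCast,
    Polynomial.derivative_one, map_mul, map_sub, map_add, map_natCast, map_ofNat, map_one, Nat.cast_add,
    Nat.cast_one]
  ring

lemma coeff_zero_clearedSeries {c : ℕ → ℕ → Tan d → Fin p → ℝ}
    (h1 : Set.EqOn (c 1 0) 0 (Metric.ball 0 r)) {y : Tan d} (hy : y ∈ Metric.ball 0 r)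
    (s : Fin p) : PowerSeries.coeff 0 (clearedSeries c y s) = 0 := by
  have hc : comp c s 1 0 y = 0 := congrFun (h1 hy) s
  have hd := coeff_zero_dt_ser (comp c s) y
  rw [hc, map_zero, PowerSeries.coeff_zero_eq_constantCoeff_apply] at hd
  simp only [clearedSeries, clearedOp, fd1_last, PowerSeries.coeff_zero_eq_constantCoeff_apply,
    map_sub, map_sum, map_mul, hd, PowerSeries.constantCoeff_X, zero_mul, mul_zero,
    Finset.sum_const_zero, sub_zero]

/-- The coefficients of the cleared system below `t ^ (m - 1)` depend only on the coefficients of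
the series below `t ^ m`. -/
lemma coeff_clearedSeries_congr {m i : ℕ} {c c' : ℕ → ℕ → Tan d → Fin p → ℝ}
    (h : ∀ s, AgreeBelow r m (comp c s) (comp c' s))
    (h1 : Set.EqOn (c 1 0) 0 (Metric.ball 0 r)) (h1' : Set.EqOn (c' 1 0) 0 (Metric.ball 0 r))
    {y : Tan d} (hy : y ∈ Metric.ball 0 r) (hi : i + 1 < m) (s : Fin p) :
    PowerSeries.coeff i (clearedSeries c y s) = PowerSeries.coeff i (clearedSeries c' y s) := by
  cases i with
  | zero => rw [coeff_zero_clearedSeries h1 hy, coeff_zero_clearedSeries h1' hy]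
  | succ k =>
    have := coeff_clearedSeries_sub (k := k) (fun s => (h s).mono (by omega)) h1 hy s
    rw [(h s).coeff_ser_eq (by omega) hy, sub_self] at this
    rw [← sub_eq_zero, this]
    simp [logOp]

/-! ### Bounds on the powers of the logarithm -/

/-- The series in which `t ^ i (log t) ^ j` occurs only if `N * j ≤ i`. -/
def logSubring (N : ℕ) : Subring LogSeries where
  carrier := {f | ∀ i j, i < N * j → (PowerSeries.coeff i f).coeff j = 0}
  mul_mem' := by
    intro f g hf hg i j hij
    rw [PowerSeries.coeff_mul, Polynomial.finsetSum_coeff]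
    refine Finset.sum_eq_zero fun x hx => ?_
    rw [Polynomial.coeff_mul]
    refine Finset.sum_eq_zero fun z hz => ?_
    rw [Finset.HasAntidiagonal.mem_antidiagonal] at hx hz
    rcases lt_or_ge x.1 (N * z.1) with h | h
    · rw [hf _ _ h, zero_mul]
    · rw [hg, mul_zero]
      rw [← hx, ← hz, mul_add] at hij
      omega
  one_mem' := by
    intro i j hij
    have hj : j ≠ 0 := by
      rintro rfl
      simp at hij
    rw [PowerSeries.coeff_one]
    split_ifs <;> simp [Polynomial.coeff_one, hj]
  add_mem' := by
    intro f g hf hg i j hij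
    rw [map_add, Polynomial.coeff_add, hf i j hij, hg i j hij, add_zero]
  zero_mem' := by
    intro i j _
    simp
  neg_mem' := by
    intro f hf i j hij
    rw [map_neg, Polynomial.coeff_neg, hf i j hij, neg_zero]

/-- In the series with coefficients `a`, the term `t ^ i (log t) ^ j` with `i ≥ 1` occurs only if
`N * j ≤ i - 1`. -/
def LogBound (r : ℝ) (N : ℕ) (a : ℕ → ℕ → Tan d → ℝ) : Prop :=
  ∀ i, ∀ j ≤ logDeg d i, i - 1 < N * j → Set.EqOn (a i j) 0 (Metric.ball 0 r)

lemma logBound_self (a : ℕ → ℕ → Tan d → ℝ) : LogBound r (d + 1) a := by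
  intro i j hj hij
  have := Nat.div_mul_le_self (i - 1) (d + 1)
  have h2 := Nat.mul_le_mul_left (d + 1) hj
  rw [logDeg, mul_comm] at h2
  nlinarith

lemma LogBound.coefDeriv {N : ℕ} {a : ℕ → ℕ → Tan d → ℝ} (h : LogBound r N a) (β : Fin d) :
    LogBound r N (coefDeriv β a) :=
  fun i j hj hij => tanDeriv_eqOn_zero (h i j hj hij) β

lemma LogBound.coeff_ser {N : ℕ} {a : ℕ → ℕ → Tan d → ℝ} (h : LogBound r N a) {y : Tan d}
    (hy : y ∈ Metric.ball 0 r) {i j : ℕ} (hij : i - 1 < N * j) :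
    (PowerSeries.coeff i (ser a y)).coeff j = 0 := by
  rw [MinSys.coeff_ser]
  split_ifs with hj
  · exact h i j hj hij hy
  · rfl

lemma LogBound.fd1_mem {N : ℕ} {a : ℕ → ℕ → Tan d → ℝ} (h : LogBound r N a) {y : Tan d}
    (hy : y ∈ Metric.ball 0 r) (i : Fin (d + 1)) : fd1 i a y ∈ logSubring N := by
  refine Fin.lastCases ?_ (fun β => ?_) i
  · intro i j hij
    have : N * j ≤ N * (j + 1) := Nat.mul_le_mul_left _ (Nat.le_succ j)
    rw [fd1_last, coeff_coeff_dt, h.coeff_ser hy (by omega), h.coeff_ser hy (by omega)]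
    simp
  · intro i j hij
    rw [fd1_castSucc, (h.coefDeriv β).coeff_ser hy (by omega)]

lemma X_mul_mem_logSubring {N : ℕ} {f : LogSeries} (h : f ∈ logSubring N) :
    PowerSeries.X * f ∈ logSubring N := by
  refine Subring.mul_mem _ ?_ h
  intro i j hij
  have hj : j ≠ 0 := by
    rintro rfl
    simp at hij
  rw [PowerSeries.coeff_X]
  split_ifs <;> simp [Polynomial.coeff_one, hj]

lemma LogBound.X_mul_fd2_mem {N : ℕ} {a : ℕ → ℕ → Tan d → ℝ} (h : LogBound r N a) {y : Tan d}
    (hy : y ∈ Metric.ball 0 r) (i j : Fin (d + 1)) :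
    PowerSeries.X * fd2 i j a y ∈ logSubring N := by
  refine Fin.lastCases ?_ (fun β => ?_) i
  · refine Fin.lastCases ?_ (fun γ => ?_) j
    · intro i j hij
      cases i with
      | zero => simp
      | succ i =>
        have h1 : N * j ≤ N * (j + 1) := Nat.mul_le_mul_left _ (Nat.le_succ j)
        have h2 : N * j ≤ N * (j + 1 + 1) := Nat.mul_le_mul_left _ (by omega)
        rw [PowerSeries.coeff_succ_X_mul, fd2_last, fd1_last, coeff_coeff_dt, coeff_coeff_dt,
          coeff_coeff_dt, h.coeff_ser hy (by omega), h.coeff_ser hy (by omega),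
          h.coeff_ser hy (by omega)]
        simp
    · rw [fd2_last, fd1_castSucc, ← fd1_last]
      exact X_mul_mem_logSubring ((h.coefDeriv γ).fd1_mem hy _)
  · rw [fd2_castSucc]
    exact X_mul_mem_logSubring ((h.coefDeriv β).fd1_mem hy _)

lemma clearedSeries_mem_logSubring {N : ℕ} {c : ℕ → ℕ → Tan d → Fin p → ℝ}
    (h : ∀ s, LogBound r N (comp c s)) {y : Tan d} (hy : y ∈ Metric.ball 0 r) (s : Fin p) :
    clearedSeries c y s ∈ logSubring N :=
  clearedOp_mem _ (fun i l => (h l).fd1_mem hy i) (fun i j l => (h l).X_mul_fd2_mem hy i j) s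

/-! ### Parity -/

/-- Only even powers of `t` occur in the series with coefficients `a`. -/
def EvenFam (r : ℝ) (a : ℕ → ℕ → Tan d → ℝ) : Prop :=
  ∀ i, Odd i → ∀ j ≤ logDeg d i, Set.EqOn (a i j) 0 (Metric.ball 0 r)

lemma EvenFam.coefDeriv {a : ℕ → ℕ → Tan d → ℝ} (h : EvenFam r a) (β : Fin d) :
    EvenFam r (coefDeriv β a) :=
  fun i hi j hj => tanDeriv_eqOn_zero (h i hi j hj) β

lemma EvenFam.rescale_ser {a : ℕ → ℕ → Tan d → ℝ} (h : EvenFam r a) {y : Tan d}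
    (hy : y ∈ Metric.ball 0 r) :
    PowerSeries.rescale (-1 : Polynomial ℝ) (ser a y) = ser a y := by
  ext i : 1
  rw [PowerSeries.coeff_rescale]
  rcases Nat.even_or_odd i with hi | hi
  · rw [hi.neg_one_pow, one_mul]
  · have : PowerSeries.coeff i (ser a y) = 0 := by
      ext j
      rw [coeff_ser]
      split_ifs with hj
      · exact h i hi j hj hy
      · rfl
    rw [this, mul_zero]

lemma rescale_dt (f : LogSeries) : PowerSeries.rescale (-1 : Polynomial ℝ) (dt f)
    = -dt (PowerSeries.rescale (-1 : Polynomial ℝ) f) := by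
  ext i : 1
  rw [map_neg, PowerSeries.coeff_rescale, coeff_dt, coeff_dt, PowerSeries.coeff_rescale]
  rcases Nat.even_or_odd i with hi | hi
  · rw [hi.neg_one_pow, hi.add_one.neg_one_pow]
    simp only [neg_mul, one_mul, Polynomial.derivative_neg]
    ring
  · rw [hi.neg_one_pow, hi.add_one.neg_one_pow]
    simp only [neg_mul, one_mul]

/-- The cleared system for a series in even powers of `t` has only odd powers of `t`. -/
lemma coeff_clearedSeries_of_even {c : ℕ → ℕ → Tan d → Fin p → ℝ}
    (h : ∀ s, EvenFam r (comp c s)) {y : Tan d} (hy : y ∈ Metric.ball 0 r) (s : Fin p) {i : ℕ}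
    (hi : Even i) : PowerSeries.coeff i (clearedSeries c y s) = 0 := by
  set e : Fin (d + 1) → LogSeries :=
    fun i => Fin.lastCases (motive := fun _ => LogSeries) (-1) (fun _ => 1) i with he
  have e1 : ∀ {a : ℕ → ℕ → Tan d → ℝ}, EvenFam r a → ∀ i,
      PowerSeries.rescale (-1 : Polynomial ℝ) (fd1 i a y) = e i * fd1 i a y := by
    intro a ha i
    refine Fin.lastCases ?_ (fun β => ?_) i
    · simp [he, rescale_dt, ha.rescale_ser hy]
    · simp [he, (ha.coefDeriv β).rescale_ser hy]
  have e2 : ∀ l i j, PowerSeries.rescale (-1 : Polynomial ℝ)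
      (PowerSeries.X * fd2 i j (comp c l) y)
      = -(e i * e j * (PowerSeries.X * fd2 i j (comp c l) y)) := by
    intro l i j
    rw [map_mul, PowerSeries.rescale_neg_one_X]
    refine Fin.lastCases ?_ (fun β => ?_) i
    · refine Fin.lastCases ?_ (fun γ => ?_) j
      · simp [he, rescale_dt, dt_neg, (h l).rescale_ser hy]
      · simp [he, rescale_dt, ((h l).coefDeriv γ).rescale_ser hy]
    · rw [fd2_castSucc, e1 ((h l).coefDeriv β)]
      simp [he]
      ring
  have e3 : PowerSeries.rescale (-1 : Polynomial ℝ) (clearedSeries c y s)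
      = -clearedSeries c y s := by
    rw [clearedSeries, map_clearedOp]
    simp only [e1 (h _), e2]
    refine clearedOp_sign (fun i => ?_) ?_ s
    · refine Fin.lastCases ?_ (fun β => ?_) i <;> simp [he]
    · simp [he]
  have := congrArg (PowerSeries.coeff i) e3
  rw [PowerSeries.coeff_rescale, hi.neg_one_pow, one_mul, map_neg] at this
  exact self_eq_neg.1 this

/-! ### Families of series with smooth coefficients -/

/-- Families of formal series over `y'` whose coefficients are smooth on the ball. -/
def smoothFam (d : ℕ) (r : ℝ) : Subring (Tan d → LogSeries) where
  carrier := {F | ∀ i j, ContDiffOn ℝ ∞ (fun y => (PowerSeries.coeff i (F y)).coeff j)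
    (Metric.ball 0 r)}
  mul_mem' := by
    intro F G hF hG i j
    simp only [Pi.mul_apply, PowerSeries.coeff_mul, Polynomial.finsetSum_coeff,
      Polynomial.coeff_mul]
    exact ContDiffOn.sum fun x _ => ContDiffOn.sum fun z _ => (hF _ _).mul (hG _ _)
  one_mem' := fun i j => contDiffOn_const
  add_mem' := by
    intro F G hF hG i j
    simp only [Pi.add_apply, map_add, Polynomial.coeff_add]
    exact (hF i j).add (hG i j)
  zero_mem' := fun i j => contDiffOn_const
  neg_mem' := by
    intro F hF i j
    simp only [Pi.neg_apply, map_neg, Polynomial.coeff_neg]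
    exact (hF i j).neg

lemma mem_smoothFam {F : Tan d → LogSeries} : F ∈ smoothFam d r ↔ ∀ i j,
    ContDiffOn ℝ ∞ (fun y => (PowerSeries.coeff i (F y)).coeff j) (Metric.ball 0 r) := Iff.rfl

/-- The coefficients that occur in the series are smooth on the ball. -/
def SmoothCoef (r : ℝ) (a : ℕ → ℕ → Tan d → ℝ) : Prop :=
  ∀ i, ∀ j ≤ logDeg d i, ContDiffOn ℝ ∞ (a i j) (Metric.ball 0 r)

lemma SmoothCoef.coefDeriv {a : ℕ → ℕ → Tan d → ℝ} (h : SmoothCoef r a) (β : Fin d) :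
    SmoothCoef r (coefDeriv β a) := fun i j hj => contDiffOn_tanDeriv (h i j hj) β

lemma SmoothCoef.ser_mem {a : ℕ → ℕ → Tan d → ℝ} (h : SmoothCoef r a) :
    (fun y => ser a y) ∈ smoothFam d r := by
  intro i j
  simp only [coeff_ser]
  split_ifs with hj
  · exact h i j hj
  · exact contDiffOn_const

lemma dt_mem_smoothFam {F : Tan d → LogSeries} (h : F ∈ smoothFam d r) :
    (fun y => dt (F y)) ∈ smoothFam d r := by
  intro i j
  simp only [coeff_coeff_dt]
  exact (contDiffOn_const.mul (h _ _)).add ((h _ _).mul contDiffOn_const)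

lemma SmoothCoef.fd1_mem {a : ℕ → ℕ → Tan d → ℝ} (h : SmoothCoef r a) (i : Fin (d + 1)) :
    (fun y => fd1 i a y) ∈ smoothFam d r := by
  refine Fin.lastCases ?_ (fun β => ?_) i
  · simpa using dt_mem_smoothFam h.ser_mem
  · simpa using (h.coefDeriv β).ser_mem

lemma SmoothCoef.X_mul_fd2_mem {a : ℕ → ℕ → Tan d → ℝ} (h : SmoothCoef r a)
    (i j : Fin (d + 1)) :
    (fun y => PowerSeries.X * fd2 i j a y) ∈ smoothFam d r := by
  refine Subring.mul_mem (smoothFam d r) (x := fun _ => PowerSeries.X) (y := fun y => fd2 i j a y)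
    (fun i j => contDiffOn_const) ?_
  refine Fin.lastCases ?_ (fun β => ?_) i
  · simpa using dt_mem_smoothFam (h.fd1_mem j)
  · simpa using (h.coefDeriv β).fd1_mem j

lemma clearedSeries_mem_smoothFam {c : ℕ → ℕ → Tan d → Fin p → ℝ}
    (h : ∀ s, SmoothCoef r (comp c s)) (s : Fin p) :
    (fun y => clearedSeries c y s) ∈ smoothFam d r := by
  have h1 : (fun y => clearedSeries c y s) = clearedOp (fun i l y => fd1 i (comp c l) y)
      (fun i j l y => PowerSeries.X * fd2 i j (comp c l) y) s := by
    funext y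
    rw [clearedOp_apply]
    rfl
  rw [h1]
  exact clearedOp_mem (smoothFam d r) (fun i l => (h l).fd1_mem i)
    (fun i j l => (h l).X_mul_fd2_mem i j) s

lemma contDiffOn_boundaryDet {c : ℕ → ℕ → Tan d → Fin p → ℝ}
    (h : ∀ s, SmoothCoef r (comp c s)) :
    ContDiffOn ℝ ∞ (fun y => boundaryDet c y) (Metric.ball 0 r) := by
  have h3 : ∀ y, boundaryDet c y = (PowerSeries.coeff 0
      ((gram fun (i : Fin (d + 1)) l (y : Tan d) => fd1 i (comp c l) y).det y)).coeff 0 := by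
    intro y
    rw [det_gram_apply, coeff_zero_det, Polynomial.coeff_C_zero]
  simp only [h3]
  exact mem_smoothFam.1 (det_gram_mem (smoothFam d r) (fun i l => (h l).fd1_mem i)) 0 0

/-! ### The indicial operator on polynomials in the logarithm -/

lemma coeff_logOp (a b : ℝ) (q : Polynomial ℝ) (j : ℕ) :
    (logOp a b q).coeff j = a * q.coeff j + b * (q.coeff (j + 1) * (j + 1))
      + q.coeff (j + 2) * (j + 2) * (j + 1) := by
  simp only [logOp, Polynomial.coeff_add, Polynomial.coeff_C_mul, Polynomial.coeff_derivative,
    Nat.cast_add, Nat.cast_one]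
  ring

lemma eq_zero_of_logOp_eq_zero {a : ℝ} (ha : a ≠ 0) (b : ℝ) {q : Polynomial ℝ}
    (h : logOp a b q = 0) : q = 0 := by
  have := coeff_logOp a b q q.natDegree
  rw [h, Polynomial.coeff_zero, Polynomial.coeff_eq_zero_of_natDegree_lt (Nat.lt_succ_self _),
    Polynomial.coeff_eq_zero_of_natDegree_lt (n := q.natDegree + 2) (by omega)] at this
  simpa [ha] using this

/-- The solution `q` of `a q + b q' + q'' = f` for `f` of degree less than `M` and `a ≠ 0`, that is,
the Neumann series of the nilpotent operator `b ∂ + ∂ ^ 2` cut off after `M` terms. -/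
noncomputable def logInv (a b : ℝ) : ℕ → Polynomial ℝ → Polynomial ℝ
  | 0, _ => 0
  | M + 1, f => Polynomial.C a⁻¹ * f + logInv a b M (Polynomial.C (-a⁻¹) * logOp 0 b f)

lemma logOp_logInv {a : ℝ} (ha : a ≠ 0) (b : ℝ) (M : ℕ) (f : Polynomial ℝ)
    (hf : ∀ j ≥ M, f.coeff j = 0) : logOp a b (logInv a b M f) = f := by
  induction M generalizing f with
  | zero =>
    have : f = 0 := by
      ext j
      simpa using hf j (Nat.zero_le j)
    rw [this]
    simp [logInv, logOp]
  | succ M ih =>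
    have h1 := ih (Polynomial.C (-a⁻¹) * logOp 0 b f) (fun j hj => by
      rw [Polynomial.coeff_C_mul, coeff_logOp, hf (j + 1) (by omega), hf (j + 2) (by omega)]
      simp)
    have h2 : logOp a b (logInv a b (M + 1) f) = logOp a b (Polynomial.C a⁻¹ * f)
        + logOp a b (logInv a b M (Polynomial.C (-a⁻¹) * logOp 0 b f)) := by
      ext j
      simp only [logInv, coeff_logOp, Polynomial.coeff_add]
      ring
    rw [h2, h1]
    ext j
    simp only [coeff_logOp, Polynomial.coeff_add, Polynomial.coeff_C_mul]
    field_simp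
    ring

lemma coeff_logInv (a b : ℝ) (M : ℕ) (f : Polynomial ℝ) (hf : ∀ j ≥ M, f.coeff j = 0) {j : ℕ}
    (hj : M ≤ j) : (logInv a b M f).coeff j = 0 := by
  induction M generalizing f j with
  | zero => simp [logInv]
  | succ M ih =>
    rw [logInv, Polynomial.coeff_add, Polynomial.coeff_C_mul, hf j hj, mul_zero, zero_add]
    refine ih _ (fun i hi => ?_) (by omega)
    rw [Polynomial.coeff_C_mul, coeff_logOp, hf (i + 1) (by omega), hf (i + 2) (by omega)]
    simp

lemma contDiffOn_coeff_logInv (a b : ℝ) (M : ℕ) {f : Tan d → Polynomial ℝ}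
    (hf : ∀ j, ContDiffOn ℝ ∞ (fun y => (f y).coeff j) (Metric.ball 0 r)) (j : ℕ) :
    ContDiffOn ℝ ∞ (fun y => (logInv a b M (f y)).coeff j) (Metric.ball 0 r) := by
  induction M generalizing f j with
  | zero => simpa [logInv] using contDiffOn_const
  | succ M ih =>
    simp only [logInv, Polynomial.coeff_add, Polynomial.coeff_C_mul]
    refine (contDiffOn_const.mul (hf j)).add (ih (fun i => ?_) j)
    simp only [Polynomial.coeff_C_mul, coeff_logOp]
    exact contDiffOn_const.mul (((contDiffOn_const.mul (hf _)).add
      (contDiffOn_const.mul ((hf _).mul contDiffOn_const))).add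
      (((hf _).mul contDiffOn_const).mul contDiffOn_const))

/-! ### Uniqueness and parity of formal solutions -/

lemma IsFormalSolution.coeff_eq_zero {φ : Tan d → Fin p → ℝ} {c : ℕ → ℕ → Tan d → Fin p → ℝ}
    (h : IsFormalSolution r φ c) {y : Tan d} (hy : y ∈ Metric.ball 0 r) (s : Fin p) (i : ℕ) :
    PowerSeries.coeff i (clearedSeries c y s) = 0 := by
  rw [(formallySolves_iff c).1 h.solves y hy s, map_zero]

lemma IsFormalSolution.smoothCoef {φ : Tan d → Fin p → ℝ} {c : ℕ → ℕ → Tan d → Fin p → ℝ}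
    (h : IsFormalSolution r φ c) (s : Fin p) : SmoothCoef r (comp c s) :=
  fun i j hj => contDiffOn_pi.1 (h.smooth i j hj) s

lemma logOp_eq_zero_of_coeff_sub {k : ℕ} {c c' : ℕ → ℕ → Tan d → Fin p → ℝ}
    (h : ∀ s, AgreeBelow r (k + 2) (comp c s) (comp c' s))
    (h1 : Set.EqOn (c 1 0) 0 (Metric.ball 0 r)) {y : Tan d} (hy : y ∈ Metric.ball 0 r)
    {s : Fin p} (hc : PowerSeries.coeff (k + 1) (clearedSeries c y s) = 0)
    (hc' : PowerSeries.coeff (k + 1) (clearedSeries c' y s) = 0) :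
    logOp (((k : ℝ) + 2) * (k - d)) (2 * k + 2 - d)
      (PowerSeries.coeff (k + 2) (ser (comp c s) y)
        - PowerSeries.coeff (k + 2) (ser (comp c' s) y)) = 0 := by
  have := coeff_clearedSeries_sub h h1 hy s
  rw [hc, hc', sub_zero, eq_comm, mul_eq_zero, Polynomial.C_eq_zero] at this
  exact this.resolve_left (boundaryDet_pos c' y).ne'

lemma indicial_ne_zero {k : ℕ} (h : k ≠ d) : ((k : ℝ) + 2) * (k - d) ≠ 0 :=
  mul_ne_zero (by positivity) (sub_ne_zero.2 (Nat.cast_injective.ne h))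

lemma logDeg_resonant (d : ℕ) : logDeg d (d + 2) = 1 := by
  simp [logDeg]

lemma logDeg_of_le {i : ℕ} (h : i ≤ d + 1) : logDeg d i = 0 :=
  Nat.div_eq_of_lt (by omega)

lemma IsFormalSolution.agreeBelow {φ : Tan d → Fin p → ℝ} {c c' : ℕ → ℕ → Tan d → Fin p → ℝ}
    (h : IsFormalSolution r φ c) (h' : IsFormalSolution r φ c')
    (hb : Set.EqOn (c' (d + 2) 0) (c (d + 2) 0) (Metric.ball 0 r)) (m : ℕ) :
    ∀ s, AgreeBelow r m (comp c' s) (comp c s) := by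
  induction m with
  | zero => exact fun s i hi => absurd hi (Nat.not_lt_zero i)
  | succ m ih =>
    intro s i hi j hj y hy
    rcases (Nat.lt_succ_iff_lt_or_eq.1 hi) with hi | rfl
    · exact ih s i hi j hj hy
    match i, hj, ih with
    | 0, hj, _ =>
      obtain rfl : j = 0 := by simpa [logDeg] using hj
      exact congrFun ((h'.zero hy).trans (h.zero hy).symm) s
    | 1, hj, _ =>
      obtain rfl : j = 0 := by simpa [logDeg] using hj
      exact congrFun ((h'.one hy).trans (h.one hy).symm) s
    | k + 2, hj, ih =>
      have hL := logOp_eq_zero_of_coeff_sub ih h'.one hy (h'.coeff_eq_zero hy s (k + 1))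
        (h.coeff_eq_zero hy s (k + 1))
      set q := PowerSeries.coeff (k + 2) (ser (comp c' s) y)
        - PowerSeries.coeff (k + 2) (ser (comp c s) y) with hq
      have hqj : ∀ j, q.coeff j = if j ≤ logDeg d (k + 2)
          then comp c' s (k + 2) j y - comp c s (k + 2) j y else 0 := by
        intro j
        rw [hq, Polynomial.coeff_sub, coeff_ser, coeff_ser]
        split_ifs <;> simp
      suffices hq0 : q.coeff j = 0 by
        rw [hqj, if_pos hj] at hq0
        exact sub_eq_zero.1 hq0
      by_cases hk : k = d
      · -- at the resonant exponent the constant term is prescribed, and the equation fixes the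
        -- coefficient of `log t`
        subst hk
        rw [logDeg_resonant] at hqj hj
        have h0 : q.coeff 0 = 0 := by
          rw [hqj, if_pos (Nat.zero_le _)]
          exact sub_eq_zero.2 (congrFun (hb hy) s)
        have h2 : q.coeff 2 = 0 := by rw [hqj, if_neg (by norm_num)]
        have := coeff_logOp (((k : ℝ) + 2) * (k - k)) (2 * k + 2 - k) q 0
        rw [hL, h0] at this
        simp only [Polynomial.coeff_zero, mul_zero, zero_add, h2, CharP.cast_eq_zero, mul_one,
          zero_mul, add_zero] at this
        have h1 : q.coeff 1 = 0 :=
          (mul_eq_zero.1 this.symm).resolve_left (by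
            have : (0 : ℝ) ≤ k := Nat.cast_nonneg k
            linarith)
        interval_cases j
        · exact h0
        · exact h1
      · rw [eq_zero_of_logOp_eq_zero (indicial_ne_zero hk) _ hL, Polynomial.coeff_zero]

/-- The family of coefficients of the partial sum of all terms with `i ≤ k`. -/
def truncFam (k : ℕ) (c : ℕ → ℕ → Tan d → Fin p → ℝ) : ℕ → ℕ → Tan d → Fin p → ℝ :=
  fun i j => if i ≤ k then c i j else 0

lemma agreeBelow_truncFam (k : ℕ) (c : ℕ → ℕ → Tan d → Fin p → ℝ) (s : Fin p) :
    AgreeBelow r (k + 1) (comp c s) (comp (truncFam k c) s) := by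
  intro i hi j _ y _
  simp [comp, truncFam, Nat.lt_succ_iff.1 hi]

lemma coeff_ser_truncFam {k i : ℕ} (h : k < i) (c : ℕ → ℕ → Tan d → Fin p → ℝ) (s : Fin p)
    (y : Tan d) : PowerSeries.coeff i (ser (comp (truncFam k c) s) y) = 0 := by
  ext j
  simp [coeff_ser, comp, truncFam, h.not_ge]

/-- If the coefficients of odd powers of `t` up to `k` vanish, then the partial sum of order
`k ≤ n` has only even powers of `t`. -/
lemma evenFam_truncFam {k : ℕ} (hk : k ≤ d + 1) {c : ℕ → ℕ → Tan d → Fin p → ℝ}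
    (h : ∀ i ≤ k, Odd i → Set.EqOn (c i 0) 0 (Metric.ball 0 r)) (s : Fin p) :
    EvenFam r (comp (truncFam k c) s) := by
  intro i hi j hj y hy
  by_cases hik : i ≤ k
  · rw [logDeg_of_le (hik.trans hk), Nat.le_zero] at hj
    subst hj
    simpa [comp, truncFam, hik] using congrFun (h i hik hi hy) s
  · simp [comp, truncFam, hik]

lemma IsFormalSolution.odd_eq_zero {φ : Tan d → Fin p → ℝ} {c : ℕ → ℕ → Tan d → Fin p → ℝ}
    (h : IsFormalSolution r φ c) (i : ℕ) (hi : i ≤ d + 1) (hodd : Odd i) :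
    Set.EqOn (c i 0) 0 (Metric.ball 0 r) := by
  induction i using Nat.strong_induction_on with
  | _ i ih =>
    match i, ih with
    | 0, _ => simp at hodd
    | 1, _ => exact h.one
    | k + 2, ih =>
      intro y hy
      funext s
      have heven : Even (k + 1) := by
        rcases Nat.even_or_odd (k + 1) with h | h
        · exact h
        · exact absurd hodd (Nat.not_odd_iff_even.2 h.add_one)
      have hL := logOp_eq_zero_of_coeff_sub (c' := truncFam (k + 1) c)
        (fun s => agreeBelow_truncFam (k + 1) c s) h.one hy
        (h.coeff_eq_zero hy s (k + 1))
        (coeff_clearedSeries_of_even (evenFam_truncFam (by omega)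
          (fun i hi' ho => ih i (by omega) (by omega) ho)) hy s heven)
      rw [coeff_ser_truncFam (by omega), sub_zero] at hL
      have h0 := eq_zero_of_logOp_eq_zero (indicial_ne_zero (by omega)) _ hL
      have := coeff_ser (comp c s) y (k + 2) 0
      rw [h0, if_pos (Nat.zero_le _)] at this
      exact this.symm

/-! ### Construction of the formal solution -/

/-- A solution of the system up to order `m`, consisting of terms with `i ≤ m` only. -/
structure IsPartialSolution (r : ℝ) (φ b : Tan d → Fin p → ℝ) (m : ℕ)
    (c : ℕ → ℕ → Tan d → Fin p → ℝ) : Prop where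
  smooth : ∀ s, SmoothCoef r (comp c s)
  zero : Set.EqOn (c 0 0) φ (Metric.ball 0 r)
  one : Set.EqOn (c 1 0) 0 (Metric.ball 0 r)
  vanish : ∀ i, m < i → ∀ j, c i j = 0
  resonant : d + 2 ≤ m → Set.EqOn (c (d + 2) 0) b (Metric.ball 0 r)
  solves : ∀ i < m, ∀ y ∈ Metric.ball 0 r, ∀ s, PowerSeries.coeff i (clearedSeries c y s) = 0

lemma exists_isPartialSolution_one (φ b : Tan d → Fin p → ℝ)
    (hφ : ContDiffOn ℝ ∞ φ (Metric.ball 0 r)) :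
    ∃ c, IsPartialSolution r φ b 1 c := by
  have h1 : Set.EqOn ((fun i _ => if i = 0 then φ else 0 : ℕ → ℕ → Tan d → Fin p → ℝ) 1 0) 0
      (Metric.ball 0 r) := fun y _ => by simp
  refine ⟨fun i _ => if i = 0 then φ else 0, fun s i j _ => ?_, fun y _ => by simp, h1,
    fun i hi j => by simp [show i ≠ 0 by omega], fun h => by omega, fun i hi y hy s => ?_⟩
  · rcases i with _ | i
    · exact contDiffOn_pi.1 hφ s
    · exact contDiffOn_const
  · obtain rfl : i = 0 := by omega
    exact coeff_zero_clearedSeries h1 hy s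

/-- A solution up to order `k + 1` extends to order `k + 2` by solving the indicial equation. At
the resonant exponent `k + 2 = n + 1` the right-hand side is free of logarithms, the term
`b` is free, and a term with `log t` solves the equation. -/
lemma IsPartialSolution.exists_succ {φ b : Tan d → Fin p → ℝ}
    (hb : ContDiffOn ℝ ∞ b (Metric.ball 0 r)) {k : ℕ} {c : ℕ → ℕ → Tan d → Fin p → ℝ}
    (h : IsPartialSolution r φ b (k + 1) c) :
    ∃ c', IsPartialSolution r φ b (k + 2) c' ∧ ∀ i ≤ k + 1, c' i = c i := by
  set f : Fin p → Tan d → Polynomial ℝ := fun s y => Polynomial.C (-(boundaryDet c y)⁻¹)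
    * PowerSeries.coeff (k + 1) (clearedSeries c y s) with hf
  have hfs : ∀ s j, ContDiffOn ℝ ∞ (fun y => (f s y).coeff j) (Metric.ball 0 r) := by
    intro s j
    simp only [hf, Polynomial.coeff_C_mul]
    exact ((contDiffOn_boundaryDet h.smooth).inv fun y _ => (boundaryDet_pos c y).ne').neg.mul
      (mem_smoothFam.1 (clearedSeries_mem_smoothFam h.smooth s) _ _)
  have hfd : ∀ s, ∀ y ∈ Metric.ball 0 r, ∀ j ≥ logDeg d (k + 2) + 1, (f s y).coeff j = 0 := by
    intro s y hy j hj
    simp only [hf, Polynomial.coeff_C_mul]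
    rw [clearedSeries_mem_logSubring (fun s => logBound_self (comp c s)) hy s, mul_zero]
    have : (k + 1) / (d + 1) < j := by simpa [logDeg] using hj
    rw [mul_comm]
    exact (Nat.div_lt_iff_lt_mul (Nat.succ_pos d)).1 this
  have hf0 : k = d → ∀ s, ∀ y ∈ Metric.ball 0 r, ∀ j ≥ 1, (f s y).coeff j = 0 := by
    rintro rfl s y hy j hj
    have hB : ∀ s, LogBound r (k + 2) (comp c s) := by
      intro s i j hj hij y _
      have hi : k + 1 < i := by
        by_contra hi
        rw [logDeg_of_le (by omega), Nat.le_zero] at hj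
        subst hj
        simp at hij
      simp [comp, h.vanish i hi j]
    simp only [hf, Polynomial.coeff_C_mul]
    rw [clearedSeries_mem_logSubring hB hy s, mul_zero]
    nlinarith
  obtain ⟨q, hqs, hqd, hqL, hqb⟩ : ∃ q : Fin p → Tan d → Polynomial ℝ,
      (∀ s j, ContDiffOn ℝ ∞ (fun y => (q s y).coeff j) (Metric.ball 0 r)) ∧
      (∀ s, ∀ y ∈ Metric.ball 0 r, ∀ j, logDeg d (k + 2) < j → (q s y).coeff j = 0) ∧
      (∀ s, ∀ y ∈ Metric.ball 0 r,
        logOp (((k : ℝ) + 2) * (k - d)) (2 * k + 2 - d) (q s y) = f s y) ∧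
      (k = d → ∀ s y, (q s y).coeff 0 = b y s) := by
    by_cases hk : k = d
    · subst hk
      have hk0 : (2 * k + 2 - k : ℝ) ≠ 0 := by
        have : (0 : ℝ) ≤ k := Nat.cast_nonneg k
        linarith
      have hco : ∀ s y j, (Polynomial.C (b y s)
          + Polynomial.C ((f s y).coeff 0 / (2 * k + 2 - k)) * Polynomial.X).coeff j
          = if j = 0 then b y s else if j = 1 then (f s y).coeff 0 / (2 * k + 2 - k) else 0 := by
        intro s y j
        rw [Polynomial.coeff_add, Polynomial.coeff_C, Polynomial.coeff_C_mul, Polynomial.coeff_X]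
        rcases j with _ | _ | j <;> simp
      refine ⟨fun s y => Polynomial.C (b y s)
        + Polynomial.C ((f s y).coeff 0 / (2 * k + 2 - k)) * Polynomial.X, ?_, ?_, ?_, ?_⟩
      · intro s j
        simp only [hco]
        split_ifs
        · exact contDiffOn_pi.1 hb s
        · exact (hfs s 0).div_const _
        · exact contDiffOn_const
      · intro s y _ j hj
        rw [logDeg_resonant] at hj
        rw [hco, if_neg (by omega), if_neg (by omega)]
      · intro s y hy
        have e : (2 * k + 2 - k : ℝ) * ((f s y).coeff 0 / (2 * k + 2 - k)) = (f s y).coeff 0 := by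
          rw [← mul_div_assoc, mul_div_cancel_left₀ _ hk0]
        ext j
        rw [coeff_logOp, hco, hco, hco]
        rcases j with _ | j
        · rw [if_pos rfl, if_neg (by omega), if_pos (zero_add 1), if_neg (by omega),
            if_neg (by omega), Nat.cast_zero]
          linear_combination e
        · rw [hf0 rfl s y hy (j + 1) (by omega)]
          simp
      · intro _ s y
        simp [hco]
    · refine ⟨fun s y => logInv (((k : ℝ) + 2) * (k - d)) (2 * k + 2 - d)
        (logDeg d (k + 2) + 1) (f s y), fun s j => contDiffOn_coeff_logInv _ _ _ (hfs s) j,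
        fun s y hy j hj => coeff_logInv _ _ _ _ (hfd s y hy) hj,
        fun s y hy => logOp_logInv (indicial_ne_zero hk) _ _ _ (hfd s y hy),
        fun hk' => absurd hk' hk⟩
  set c' : ℕ → ℕ → Tan d → Fin p → ℝ :=
    fun i j => if i = k + 2 then fun y s => (q s y).coeff j else c i j with hc'
  have hlt : ∀ i, i ≠ k + 2 → c' i = c i := by
    intro i hi
    simp [hc', hi]
  have htop : ∀ j, c' (k + 2) j = fun y s => (q s y).coeff j := by
    intro j
    simp [hc']
  have hone : Set.EqOn (c' 1 0) 0 (Metric.ball 0 r) := by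
    rw [hlt 1 (by omega)]
    exact h.one
  have hag : ∀ s, AgreeBelow r (k + 2) (comp c' s) (comp c s) := by
    intro s i hi j _ y _
    simp only [comp, hlt i (by omega)]
  refine ⟨c', ⟨?_, ?_, hone, ?_, ?_, ?_⟩, fun i hi => hlt i (by omega)⟩
  · intro s i j hj
    by_cases hi : i = k + 2
    · subst hi
      have : comp c' s (k + 2) j = fun y => (q s y).coeff j := by
        funext y
        simp only [comp, htop]
      rw [this]
      exact hqs s j
    · have : comp c' s i j = comp c s i j := by
        funext y
        simp only [comp, hlt i hi]
      rw [this]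
      exact h.smooth s i j hj
  · rw [hlt 0 (by omega)]
    exact h.zero
  · intro i hi j
    rw [hlt i (by omega), h.vanish i (by omega)]
  · intro hd y hy
    by_cases hk : k = d
    · subst hk
      funext s
      exact (congrFun (congrFun (htop 0) y) s).trans (hqb rfl s y)
    · rw [hlt _ (by omega)]
      exact h.resonant (by omega) hy
  · intro i hi y hy s
    rcases (Nat.lt_succ_iff_lt_or_eq.1 hi) with hi | rfl
    · rw [coeff_clearedSeries_congr hag hone h.one hy (by omega)]
      exact h.solves i hi y hy s
    · have := coeff_clearedSeries_sub hag hone hy s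
      have hq' : PowerSeries.coeff (k + 2) (ser (comp c' s) y) = q s y := by
        ext j
        rw [coeff_ser]
        split_ifs with hj
        · simp only [comp, htop]
        · rw [hqd s y hy j (by omega)]
      have hq0 : PowerSeries.coeff (k + 2) (ser (comp c s) y) = 0 := by
        ext j
        simp [coeff_ser, comp, h.vanish (k + 2) (by omega)]
      rw [hq', hq0, sub_zero, hqL s y hy, hf, ← mul_assoc, ← Polynomial.C_mul, mul_neg,
        mul_inv_cancel₀ (boundaryDet_pos c y).ne', sub_eq_iff_eq_add] at this
      simpa using this

lemma exists_isFormalSolution (φ b : Tan d → Fin p → ℝ)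
    (hφ : ContDiffOn ℝ ∞ φ (Metric.ball 0 r)) (hb : ContDiffOn ℝ ∞ b (Metric.ball 0 r)) :
    ∃ c, IsFormalSolution r φ c ∧ Set.EqOn (c (d + 2) 0) b (Metric.ball 0 r) := by
  obtain ⟨c₁, hc₁⟩ := exists_isPartialSolution_one φ b hφ
  choose! next hnext using fun (k : ℕ) (c : ℕ → ℕ → Tan d → Fin p → ℝ)
    (h : IsPartialSolution r φ b (k + 1) c) => h.exists_succ hb
  obtain ⟨F, hF, hstep⟩ : ∃ F : ℕ → ℕ → ℕ → Tan d → Fin p → ℝ,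
      (∀ m, IsPartialSolution r φ b (m + 1) (F m)) ∧ ∀ m, ∀ i ≤ m + 1, F (m + 1) i = F m i := by
    have hF : ∀ m, IsPartialSolution r φ b (m + 1)
        (Nat.rec (motive := fun _ => ℕ → ℕ → Tan d → Fin p → ℝ) c₁ next m) := by
      intro m
      induction m with
      | zero => exact hc₁
      | succ m ih => exact (hnext m _ ih).1
    exact ⟨_, hF, fun m => (hnext m _ (hF m)).2⟩
  have hco : ∀ i m, i ≤ m → F m i = F i i := by
    intro i m him
    induction m, him using Nat.le_induction with
    | base => rfl
    | succ m hm ih => rw [hstep m i (by omega), ih]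
  obtain ⟨c, hc⟩ : ∃ c : ℕ → ℕ → Tan d → Fin p → ℝ, ∀ i, c i = F i i := ⟨_, fun _ => rfl⟩
  have hone : Set.EqOn (c 1 0) 0 (Metric.ball 0 r) := by
    rw [hc]
    exact (hF 1).one
  refine ⟨c, ⟨fun i j hj => ?_, ?_, hone, ?_⟩, ?_⟩
  · rw [hc]
    exact contDiffOn_pi.2 fun s => (hF i).smooth s i j hj
  · rw [hc]
    exact (hF 0).zero
  · rw [formallySolves_iff]
    intro y hy s
    ext k : 1
    rw [map_zero]
    have hag : ∀ s, AgreeBelow r (k + 2) (comp c s) (comp (F (k + 1)) s) := by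
      intro s i hi j _ z _
      simp only [comp, hc, hco i (k + 1) (by omega)]
    have hk := (hF (k + 1)).solves k (by omega) y hy s
    rw [← hk]
    exact coeff_clearedSeries_congr hag hone (hF (k + 1)).one hy (by omega) s
  · rw [hc]
    exact (hF (d + 2)).resonant (by omega)

/-! ### Functions represented by finite series -/

/-- Pairs consisting of a family of formal series, which are polynomials in `t` of bounded degree
for `y'` in the ball, and of the family of functions of `t > 0` obtained by substituting the
function `log t` for the formal logarithm. -/
noncomputable def finFam (d : ℕ) (r : ℝ) : Subring ((Tan d → LogSeries) × (Tan d → ℝ → ℝ)) where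
  carrier := {x | ∃ N, ∀ y ∈ Metric.ball (0 : Tan d) r, ∃ q : Polynomial (Polynomial ℝ),
    q.natDegree ≤ N ∧ (q : LogSeries) = x.1 y ∧
    ∀ t > 0, x.2 y t = q.eval₂ (Polynomial.evalRingHom (Real.log t)) t}
  mul_mem' := by
    rintro x z ⟨N, hN⟩ ⟨M, hM⟩
    refine ⟨N + M, fun y hy => ?_⟩
    obtain ⟨q, h1, h2, h3⟩ := hN y hy
    obtain ⟨q', h1', h2', h3'⟩ := hM y hy
    refine ⟨q * q', Polynomial.natDegree_mul_le.trans (add_le_add h1 h1'), ?_, fun t ht => ?_⟩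
    · rw [Polynomial.coe_mul, h2, h2']
      rfl
    · rw [Polynomial.eval₂_mul, ← h3 t ht, ← h3' t ht]
      rfl
  one_mem' := ⟨0, fun y _ => ⟨1, by simp, by simp, fun t _ => by simp⟩⟩
  add_mem' := by
    rintro x z ⟨N, hN⟩ ⟨M, hM⟩
    refine ⟨max N M, fun y hy => ?_⟩
    obtain ⟨q, h1, h2, h3⟩ := hN y hy
    obtain ⟨q', h1', h2', h3'⟩ := hM y hy
    refine ⟨q + q', (Polynomial.natDegree_add_le _ _).trans (max_le_max h1 h1'), ?_,
      fun t ht => ?_⟩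
    · rw [Polynomial.coe_add, h2, h2']
      rfl
    · rw [Polynomial.eval₂_add, ← h3 t ht, ← h3' t ht]
      rfl
  zero_mem' := ⟨0, fun y _ => ⟨0, by simp, by simp, fun t _ => by simp⟩⟩
  neg_mem' := by
    rintro x ⟨N, hN⟩
    refine ⟨N, fun y hy => ?_⟩
    obtain ⟨q, h1, h2, h3⟩ := hN y hy
    refine ⟨-q, by rwa [Polynomial.natDegree_neg], ?_, fun t ht => ?_⟩
    · rw [Polynomial.coe_neg, h2]
      rfl
    · rw [Polynomial.eval₂_neg, ← h3 t ht]
      rfl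

lemma mem_finFam {F : Tan d → LogSeries} {v : Tan d → ℝ → ℝ} :
    (F, v) ∈ finFam d r ↔ ∃ N, ∀ y ∈ Metric.ball (0 : Tan d) r,
      (∀ i > N, PowerSeries.coeff i (F y) = 0) ∧
      ∀ t > 0, v y t = ∑ i ∈ Finset.range (N + 1),
        (PowerSeries.coeff i (F y)).eval (Real.log t) * t ^ i := by
  constructor
  · rintro ⟨N, hN⟩
    refine ⟨N, fun y hy => ?_⟩
    obtain ⟨q, h1, h2, h3⟩ := hN y hy
    change (q : LogSeries) = F y at h2
    rw [← h2]
    refine ⟨fun i hi => ?_, fun t ht => ?_⟩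
    · rw [Polynomial.coeff_coe, Polynomial.coeff_eq_zero_of_natDegree_lt (by omega)]
    · refine (h3 t ht).trans ?_
      rw [Polynomial.eval₂_eq_sum_range' _ (Nat.lt_succ_of_le h1)]
      simp
  · rintro ⟨N, hN⟩
    refine ⟨N, fun y hy => ?_⟩
    obtain ⟨h1, h2⟩ := hN y hy
    refine ⟨PowerSeries.trunc (N + 1) (F y),
      Nat.lt_succ_iff.1 (PowerSeries.natDegree_trunc_lt _ _), ?_, fun t ht => ?_⟩
    · ext i : 1
      rw [Polynomial.coeff_coe, PowerSeries.coeff_trunc]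
      split_ifs with hi
      · rfl
      · exact (h1 i (by omega)).symm
    · rw [PowerSeries.eval₂_trunc_eq_sum_range]
      exact h2 t ht

lemma finFam_congr {F : Tan d → LogSeries} {v v' : Tan d → ℝ → ℝ} (h : (F, v) ∈ finFam d r)
    (hv : ∀ y ∈ Metric.ball 0 r, ∀ t > 0, v' y t = v y t) : (F, v') ∈ finFam d r := by
  rw [mem_finFam] at h ⊢
  obtain ⟨N, hN⟩ := h
  exact ⟨N, fun y hy => ⟨(hN y hy).1, fun t ht => (hv y hy t ht).trans ((hN y hy).2 t ht)⟩⟩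

lemma X_mem_finFam : ((fun _ => PowerSeries.X, fun _ t => t) :
    (Tan d → LogSeries) × (Tan d → ℝ → ℝ)) ∈ finFam d r :=
  ⟨1, fun y _ => ⟨Polynomial.X, Polynomial.natDegree_X_le, Polynomial.coe_X,
    fun t _ => by simp⟩⟩

/-- The formal `t`-derivative represents the derivative of functions. -/
lemma dt_mem_finFam {F : Tan d → LogSeries} {v : Tan d → ℝ → ℝ} (h : (F, v) ∈ finFam d r)
    (h0 : ∀ y, Polynomial.derivative (PowerSeries.coeff 0 (F y)) = 0) :
    (fun y => dt (F y), fun y t => deriv (v y) t) ∈ finFam d r := by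
  rw [mem_finFam] at h ⊢
  obtain ⟨N, hN⟩ := h
  refine ⟨N, fun y hy => ⟨fun i hi => ?_, fun t ht => ?_⟩⟩
  · rw [coeff_dt, (hN y hy).1 (i + 1) (by omega)]
    simp
  · have hterm : ∀ i ∈ Finset.range (N + 1), HasDerivAt
        (fun τ => (PowerSeries.coeff i (F y)).eval (Real.log τ) * τ ^ i)
        ((Polynomial.derivative (PowerSeries.coeff i (F y))).eval (Real.log t) * t⁻¹ * t ^ i
          + (PowerSeries.coeff i (F y)).eval (Real.log t) * (i * t ^ (i - 1))) t := by
      intro i _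
      exact (((PowerSeries.coeff i (F y)).hasDerivAt (Real.log t)).comp t
        (Real.hasDerivAt_log ht.ne')).mul (hasDerivAt_pow i t)
    have hsum := HasDerivAt.fun_sum hterm
    have hev : v y =ᶠ[nhds t] fun τ => ∑ i ∈ Finset.range (N + 1),
        (PowerSeries.coeff i (F y)).eval (Real.log τ) * τ ^ i :=
      Filter.eventuallyEq_of_mem (Ioi_mem_nhds ht) fun τ hτ => (hN y hy).2 τ hτ
    rw [hev.deriv_eq, hsum.deriv, Finset.sum_range_succ', Finset.sum_range_succ]
    have hlast : (PowerSeries.coeff N (dt (F y))) = 0 := by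
      rw [coeff_dt, (hN y hy).1 (N + 1) (by omega)]
      simp
    rw [hlast, h0]
    simp only [Polynomial.eval_zero, zero_mul, mul_zero, Nat.cast_zero, add_zero]
    refine Finset.sum_congr rfl fun i _ => ?_
    rw [coeff_dt, Polynomial.eval_add, Polynomial.eval_mul, Polynomial.eval_C, Nat.add_sub_cancel,
      pow_succ, Nat.cast_add, Nat.cast_one]
    field_simp
    ring

/-! ### Derivatives of partial sums -/

/-- The sum of all terms with `i ≤ k` of the series with coefficients `a`, as a function. -/
noncomputable def serVal (k : ℕ) (a : ℕ → ℕ → Tan d → ℝ) (y : Tan d) (t : ℝ) : ℝ :=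
  ∑ i ∈ Finset.range (k + 1), ∑ j ∈ Finset.range (logDeg d i + 1), t ^ i * Real.log t ^ j * a i j y

/-- The coefficients of all powers of `t` above `t ^ k` vanish on the ball. -/
def VanishAbove (r : ℝ) (k : ℕ) (a : ℕ → ℕ → Tan d → ℝ) : Prop :=
  ∀ i > k, ∀ j, Set.EqOn (a i j) 0 (Metric.ball 0 r)

lemma VanishAbove.coefDeriv {k : ℕ} {a : ℕ → ℕ → Tan d → ℝ} (h : VanishAbove r k a) (β : Fin d) :
    VanishAbove r k (coefDeriv β a) := fun i hi j => tanDeriv_eqOn_zero (h i hi j) β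

lemma ser_mem_finFam {k : ℕ} {a : ℕ → ℕ → Tan d → ℝ} (h : VanishAbove r k a) :
    (fun y => ser a y, serVal k a) ∈ finFam d r := by
  rw [mem_finFam]
  refine ⟨k, fun y hy => ⟨fun i hi => ?_, fun t _ => ?_⟩⟩
  · ext j
    rw [coeff_ser, h i hi j hy]
    simp
  · refine Finset.sum_congr rfl fun i _ => ?_
    rw [ser, PowerSeries.coeff_mk, Polynomial.eval_finsetSum, Finset.sum_mul]
    refine Finset.sum_congr rfl fun j _ => ?_
    rw [Polynomial.eval_monomial]
    ring

lemma tanDeriv_sum {a : ℕ → ℕ → Tan d → ℝ} (h : SmoothCoef r a) (k : ℕ) (K : ℕ → ℕ → ℝ)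
    (β : Fin d) {y : Tan d} (hy : y ∈ Metric.ball 0 r) :
    tanDeriv β (fun z => ∑ i ∈ Finset.range (k + 1), ∑ j ∈ Finset.range (logDeg d i + 1),
        K i j * a i j z) y
      = ∑ i ∈ Finset.range (k + 1), ∑ j ∈ Finset.range (logDeg d i + 1),
        K i j * coefDeriv β a i j y := by
  have hd : ∀ i, ∀ j ∈ Finset.range (logDeg d i + 1), HasLineDerivAt ℝ (a i j)
      (coefDeriv β a i j y) y (EuclideanSpace.single β 1) := by
    intro i j hj
    have : DifferentiableAt ℝ (a i j) y := ((h i j (by simpa [Nat.lt_succ_iff] using hj)).contDiffAt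
      (Metric.isOpen_ball.mem_nhds hy)).differentiableAt (by simp)
    exact this.lineDifferentiableAt.hasLineDerivAt
  refine HasLineDerivAt.lineDeriv ?_
  unfold HasLineDerivAt
  exact HasDerivAt.fun_sum fun i _ => HasDerivAt.fun_sum fun j hj => (hd i j hj).const_mul _

lemma tanDeriv_serVal {a : ℕ → ℕ → Tan d → ℝ} (h : SmoothCoef r a) (k : ℕ) (β : Fin d)
    {y : Tan d} (hy : y ∈ Metric.ball 0 r) (t : ℝ) :
    tanDeriv β (fun z => serVal k a z t) y = serVal k (coefDeriv β a) y t :=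
  tanDeriv_sum h k (fun i j => t ^ i * Real.log t ^ j) β hy

lemma deriv_serVal (k : ℕ) (a : ℕ → ℕ → Tan d → ℝ) (y : Tan d) {t : ℝ} (ht : 0 < t) :
    deriv (serVal k a y) t = ∑ i ∈ Finset.range (k + 1), ∑ j ∈ Finset.range (logDeg d i + 1),
      deriv (fun τ => τ ^ i * Real.log τ ^ j) t * a i j y := by
  refine HasDerivAt.deriv ?_
  have hd : ∀ i j : ℕ, DifferentiableAt ℝ (fun τ => τ ^ i * Real.log τ ^ j) t := fun i j =>
    (differentiableAt_pow i).mul ((Real.differentiableAt_log ht.ne').pow j)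
  exact HasDerivAt.fun_sum fun i _ => HasDerivAt.fun_sum fun j _ =>
    (hd i j).hasDerivAt.mul_const (a i j y)

lemma tanDeriv_deriv_serVal {a : ℕ → ℕ → Tan d → ℝ} (h : SmoothCoef r a) (k : ℕ) (β : Fin d)
    {y : Tan d} (hy : y ∈ Metric.ball 0 r) {t : ℝ} (ht : 0 < t) :
    tanDeriv β (fun z => deriv (serVal k a z) t) y = deriv (serVal k (coefDeriv β a) y) t := by
  simp only [deriv_serVal k _ _ ht]
  exact tanDeriv_sum h k _ β hy

lemma pd_last (f : Tan d → ℝ → ℝ) : pd (Fin.last d) f = fun y t => deriv (f y) t := by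
  funext y t
  simp [pd]

lemma pd_castSucc (β : Fin d) (f : Tan d → ℝ → ℝ) :
    pd β.castSucc f = fun y t => tanDeriv β (fun z => f z t) y := by
  funext y t
  simp [pd]

lemma pd_mem_finFam {k : ℕ} {a : ℕ → ℕ → Tan d → ℝ} (hs : SmoothCoef r a)
    (hv : VanishAbove r k a) (i : Fin (d + 1)) :
    (fun y => fd1 i a y, pd i (serVal k a)) ∈ finFam d r := by
  refine Fin.lastCases ?_ (fun β => ?_) i
  · simp only [fd1_last, pd_last]
    exact dt_mem_finFam (ser_mem_finFam hv) fun y => by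
      rw [coeff_zero_ser, Polynomial.derivative_C]
  · simp only [fd1_castSucc, pd_castSucc]
    exact finFam_congr (ser_mem_finFam (hv.coefDeriv β)) fun y hy t _ => tanDeriv_serVal hs k β hy t

lemma pd_pd_mem_finFam {k : ℕ} {a : ℕ → ℕ → Tan d → ℝ} (hs : SmoothCoef r a)
    (hv : VanishAbove r k a) (i j : Fin (d + 1)) :
    (fun y => fd2 j i a y, pd i (pd j (serVal k a))) ∈ finFam d r := by
  refine Fin.lastCases ?_ (fun β => ?_) i
  · rw [pd_last]
    have h1 := pd_mem_finFam hs hv j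
    refine Fin.lastCases (fun h1 => ?_) (fun γ h1 => ?_) j h1
    · simp only [fd2_last]
      refine dt_mem_finFam h1 fun y => ?_
      rw [fd1_last, coeff_zero_dt_ser, Polynomial.derivative_C]
    · simp only [fd1_castSucc] at h1
      simp only [fd2_castSucc, fd1_last]
      exact dt_mem_finFam h1 fun y => by
        rw [coeff_zero_ser, Polynomial.derivative_C]
  · rw [pd_castSucc]
    refine Fin.lastCases ?_ (fun γ => ?_) j
    · simp only [fd2_last, fd1_castSucc, pd_last]
      refine finFam_congr (v := fun y t => deriv (serVal k (coefDeriv β a) y) t) ?_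
        fun y hy t ht => tanDeriv_deriv_serVal hs k β hy ht
      exact dt_mem_finFam (ser_mem_finFam (hv.coefDeriv β)) fun y => by
        rw [coeff_zero_ser, Polynomial.derivative_C]
    · simp only [fd2_castSucc, fd1_castSucc, pd_castSucc]
      refine finFam_congr (ser_mem_finFam ((hv.coefDeriv γ).coefDeriv β)) fun y hy t _ => ?_
      rw [← tanDeriv_serVal (hs.coefDeriv γ) k β hy t]
      exact tanDeriv_congr (fun z hz => tanDeriv_serVal hs k γ hz t) β hy

/-- The minimal surface operator multiplied by `t * det g`, on functions. -/
noncomputable def clearedFun (w : Fin p → Tan d → ℝ → ℝ) (s : Fin p) (y : Tan d) (t : ℝ) : ℝ :=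
  clearedOp (fun i l => pd i (w l) y t) (fun i j l => t * pd i (pd j (w l)) y t) s

lemma clearedOp_swap {R : Type*} [CommRing R] (D : Fin (d + 1) → Fin p → R)
    (H : Fin (d + 1) → Fin (d + 1) → Fin p → R) (s : Fin p) :
    clearedOp D (fun i j l => H j i l) s = clearedOp D H s := by
  rw [clearedOp, clearedOp, Finset.sum_comm]
  simp only [adjugate_gram_comm D _]

lemma clearedFun_mem_finFam {k : ℕ} {c : ℕ → ℕ → Tan d → Fin p → ℝ}
    (hs : ∀ l, SmoothCoef r (comp c l)) (hv : ∀ l, VanishAbove r k (comp c l)) (s : Fin p) :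
    (fun y => clearedSeries c y s, clearedFun (fun l => serVal k (comp c l)) s) ∈ finFam d r := by
  have hmem := clearedOp_mem (finFam d r)
    (D := fun i l => (fun y => fd1 i (comp c l) y, pd i (serVal k (comp c l))))
    (H := fun i j l => ((fun _ => PowerSeries.X, fun _ t => t) :
        (Tan d → LogSeries) × (Tan d → ℝ → ℝ))
      * (fun y => fd2 j i (comp c l) y, pd i (pd j (serVal k (comp c l)))))
    (fun i l => pd_mem_finFam (hs l) (hv l) i)
    (fun i j l => Subring.mul_mem _ X_mem_finFam (pd_pd_mem_finFam (hs l) (hv l) i j)) s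
  have h1 := map_clearedOp (RingHom.fst (Tan d → LogSeries) (Tan d → ℝ → ℝ))
    (fun i l => (fun y => fd1 i (comp c l) y, pd i (serVal k (comp c l))))
    (fun i j l => ((fun _ => PowerSeries.X, fun _ t => t) :
        (Tan d → LogSeries) × (Tan d → ℝ → ℝ))
      * (fun y => fd2 j i (comp c l) y, pd i (pd j (serVal k (comp c l))))) s
  have h2 := map_clearedOp (RingHom.snd (Tan d → LogSeries) (Tan d → ℝ → ℝ))
    (fun i l => (fun y => fd1 i (comp c l) y, pd i (serVal k (comp c l))))
    (fun i j l => ((fun _ => PowerSeries.X, fun _ t => t) :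
        (Tan d → LogSeries) × (Tan d → ℝ → ℝ))
      * (fun y => fd2 j i (comp c l) y, pd i (pd j (serVal k (comp c l))))) s
  simp only [map_mul, RingHom.coe_fst, RingHom.coe_snd] at h1 h2
  convert hmem using 1
  refine Prod.ext ?_ ?_
  · rw [h1]
    funext y
    change clearedSeries c y s = _
    rw [clearedSeries, ← clearedOp_swap, clearedOp_apply]
    rfl
  · rw [h2]
    funext y t
    change clearedFun (fun l => serVal k (comp c l)) s y t = _
    rw [clearedFun, clearedOp_apply, clearedOp_apply]
    rfl

/-- As the determinant of the metric is at least `1`, the operator `Q` is bounded by the cleared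
operator divided by `t`. -/
lemma abs_Q_le (w : Tan d → ℝ → Fin p → ℝ) (y : Tan d) {t : ℝ} (ht : 0 < t) (s : Fin p) :
    |Q w y t s| ≤ |clearedFun (fun l z τ => w z τ l) s y t| / t := by
  have hg : metric w y t = gram fun i l => pd i (fun z τ => w z τ l) y t := rfl
  have h1 := one_le_det_gram fun i l => pd i (fun z τ => w z τ l) y t
  rw [← hg] at h1
  have hdet : (metric w y t).det ≠ 0 := by linarith
  have key : clearedFun (fun l z τ => w z τ l) s y t = (metric w y t).det * (t * Q w y t s) := by
    rw [clearedFun, clearedOp, Q, ← hg, Matrix.inv_def, Ring.inverse_eq_inv', mul_sub, mul_sub]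
    congr 1
    · simp only [Finset.mul_sum, Matrix.smul_apply, smul_eq_mul]
      refine Finset.sum_congr rfl fun i _ => Finset.sum_congr rfl fun j _ => ?_
      field_simp
    · field_simp
  rw [le_div_iff₀ ht, key, abs_mul, abs_mul, abs_of_pos ht, abs_of_pos (zero_lt_one.trans_le h1),
    mul_comm t]
  exact le_mul_of_one_le_left (by positivity) h1

/-! ### Estimates for finite series -/

lemma one_le_abs_log {t : ℝ} (ht : 0 < t) (h : t < Real.exp (-1)) : 1 ≤ |Real.log t| := by
  have : Real.log t < -1 := (Real.log_lt_iff_lt_exp ht).2 h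
  rw [abs_of_neg (by linarith)]
  linarith

lemma mul_abs_log_pow_le {t : ℝ} (ht : 0 < t) (h : t < Real.exp (-1)) (j : ℕ) :
    t * |Real.log t| ^ j ≤ j.factorial := by
  have h1 := Real.pow_div_factorial_le_exp _ (abs_nonneg (Real.log t)) j
  have h2 : Real.log t < -1 := (Real.log_lt_iff_lt_exp ht).2 h
  have h3 : Real.exp |Real.log t| = t⁻¹ := by
    rw [abs_of_neg (by linarith), Real.exp_neg, Real.exp_log ht]
  have hj : (0 : ℝ) < j.factorial := by exact_mod_cast j.factorial_pos
  rw [h3, div_le_iff₀ hj] at h1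
  calc t * |Real.log t| ^ j ≤ t * (t⁻¹ * j.factorial) := by gcongr
    _ = j.factorial := by field_simp

/-- A finite series with smooth coefficients whose leading term is `t ^ k` times a polynomial of
degree at most `M` in `log t` is `O (t ^ k |log t| ^ M)`, locally uniformly in `y'`. -/
lemma exists_bound_of_mem_finFam {F : Tan d → LogSeries} {v : Tan d → ℝ → ℝ}
    (h : (F, v) ∈ finFam d r) (hF : F ∈ smoothFam d r) {k M : ℕ}
    (hlog : ∀ y ∈ Metric.ball 0 r, F y ∈ logSubring (d + 1))
    (hlow : ∀ y ∈ Metric.ball 0 r, ∀ i < k, PowerSeries.coeff i (F y) = 0)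
    (hlead : ∀ y ∈ Metric.ball 0 r, ∀ j > M, (PowerSeries.coeff k (F y)).coeff j = 0)
    {K : Set (Tan d)} (hK : K ⊆ Metric.ball 0 r) (hKc : IsCompact K) :
    ∃ C, ∀ y ∈ K, ∀ t ∈ Set.Ioo 0 (Real.exp (-1)),
      |v y t| ≤ C * (t ^ k * |Real.log t| ^ M) := by
  obtain ⟨N, hN⟩ := mem_finFam.1 h
  have hb : ∀ i j, ∃ B, ∀ y ∈ K, ‖(PowerSeries.coeff i (F y)).coeff j‖ ≤ B := fun i j =>
    hKc.exists_bound_of_continuousOn ((mem_smoothFam.1 hF i j).continuousOn.mono hK)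
  choose B hB using hb
  refine ⟨∑ i ∈ Finset.range (N + 1), ∑ j ∈ Finset.range (i + 1), B i j * j.factorial,
    fun y hy t ht => ?_⟩
  obtain ⟨ht0, ht1⟩ := ht
  have hL := one_le_abs_log ht0 ht1
  have hyb := hK hy
  have hdeg : ∀ i, (PowerSeries.coeff i (F y)).natDegree < i + 1 := by
    intro i
    rw [Nat.lt_succ_iff, Polynomial.natDegree_le_iff_coeff_eq_zero]
    intro j hj
    refine hlog y hyb i j ?_
    nlinarith
  have hv : v y t = ∑ i ∈ Finset.range (N + 1), ∑ j ∈ Finset.range (i + 1),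
      (PowerSeries.coeff i (F y)).coeff j * Real.log t ^ j * t ^ i := by
    rw [(hN y hyb).2 t ht0]
    refine Finset.sum_congr rfl fun i _ => ?_
    rw [Polynomial.eval_eq_sum_range' (hdeg i), Finset.sum_mul]
  rw [hv, Finset.sum_mul]
  refine (Finset.abs_sum_le_sum_abs _ _).trans (Finset.sum_le_sum fun i _ => ?_)
  rw [Finset.sum_mul]
  refine (Finset.abs_sum_le_sum_abs _ _).trans (Finset.sum_le_sum fun j _ => ?_)
  have hBij := hB i j y hy
  rw [Real.norm_eq_abs] at hBij
  have hB0 : 0 ≤ B i j := (abs_nonneg _).trans hBij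
  have hfac : (1 : ℝ) ≤ j.factorial := by exact_mod_cast j.factorial_pos
  have hLM : 1 ≤ |Real.log t| ^ M := one_le_pow₀ hL
  by_cases hz : (PowerSeries.coeff i (F y)).coeff j = 0
  · rw [hz, zero_mul, zero_mul, abs_zero]
    positivity
  rw [abs_mul, abs_mul, abs_pow, abs_pow, abs_of_pos ht0, mul_assoc, mul_assoc]
  refine mul_le_mul hBij ?_ (by positivity) hB0
  rcases lt_trichotomy i k with hik | rfl | hik
  · exact absurd (by rw [hlow y hyb i hik, Polynomial.coeff_zero]) hz
  · have hjM : j ≤ M := by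
      by_contra hjM
      exact hz (hlead y hyb j (by omega))
    calc |Real.log t| ^ j * t ^ i ≤ |Real.log t| ^ M * t ^ i := by gcongr
      _ = 1 * (t ^ i * |Real.log t| ^ M) := by ring
      _ ≤ _ := by gcongr
  · have ht1' : t ≤ 1 := ht1.le.trans (Real.exp_le_one_iff.2 (by norm_num))
    calc |Real.log t| ^ j * t ^ i ≤ |Real.log t| ^ j * t ^ (k + 1) :=
          mul_le_mul_of_nonneg_left (pow_le_pow_of_le_one ht0.le ht1' hik) (by positivity)
      _ = (t * |Real.log t| ^ j) * (t ^ k * 1) := by ring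
      _ ≤ j.factorial * (t ^ k * |Real.log t| ^ M) :=
          mul_le_mul (mul_abs_log_pow_le ht0 ht1 j) (by gcongr) (by positivity) (by positivity)

/-! ### The partial sums of the formal solution -/

lemma serVal_truncFam (k : ℕ) (c : ℕ → ℕ → Tan d → Fin p → ℝ) (l : Fin p) :
    serVal k (comp (truncFam k c) l) = fun y t => partialSum c k y t l := by
  funext y t
  simp only [serVal, partialSum, Finset.sum_apply, Pi.smul_apply, smul_eq_mul]
  refine Finset.sum_congr rfl fun i hi => Finset.sum_congr rfl fun j _ => ?_
  simp [comp, truncFam, Nat.lt_succ_iff.1 (Finset.mem_range.1 hi)]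

lemma isBigOLoc_partialSum {c : ℕ → ℕ → Tan d → Fin p → ℝ}
    (hc : ∀ s, SmoothCoef r (comp c s)) (k m M : ℕ)
    (hlow : ∀ y ∈ Metric.ball 0 r, ∀ s, ∀ i < m + 1,
      PowerSeries.coeff i (clearedSeries (truncFam k c) y s) = 0)
    (hlead : ∀ y ∈ Metric.ball 0 r, ∀ s, ∀ j > M,
      (PowerSeries.coeff (m + 1) (clearedSeries (truncFam k c) y s)).coeff j = 0) :
    IsBigOLoc r (Q (partialSum c k)) (fun t => t ^ m * |Real.log t| ^ M) := by
  intro K hK hKc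
  have hs : ∀ l, SmoothCoef r (comp (truncFam k c) l) := by
    intro l i j hj
    by_cases hi : i ≤ k
    · have : comp (truncFam k c) l i j = comp c l i j := by
        funext y
        simp [comp, truncFam, hi]
      rw [this]
      exact hc l i j hj
    · have : comp (truncFam k c) l i j = fun _ => 0 := by
        funext y
        simp [comp, truncFam, hi]
      rw [this]
      exact contDiffOn_const
  have hv : ∀ l, VanishAbove r k (comp (truncFam k c) l) := by
    intro l i hi j y _
    simp [comp, truncFam, not_le.2 hi]
  have hbound := fun s => exists_bound_of_mem_finFam (clearedFun_mem_finFam hs hv s)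
    (clearedSeries_mem_smoothFam hs s)
    (fun y hy => clearedSeries_mem_logSubring (fun s => logBound_self _) hy s)
    (fun y hy => hlow y hy s) (fun y hy => hlead y hy s) hK hKc
  choose C hC using hbound
  refine ⟨∑ s, |C s|, Real.exp (-1), Real.exp_pos _, fun y hy t ht s => ?_⟩
  refine (abs_Q_le _ y ht.1 s).trans ?_
  have h1 := hC s y hy t ht
  simp only [serVal_truncFam] at h1
  have ht0 := ht.1
  rw [div_le_iff₀ ht.1]
  refine h1.trans ?_
  have h2 : C s ≤ ∑ s, |C s| := (le_abs_self _).trans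
    (Finset.single_le_sum (f := fun s => |C s|) (fun _ _ => abs_nonneg _) (Finset.mem_univ s))
  calc C s * (t ^ (m + 1) * |Real.log t| ^ M)
      ≤ (∑ s, |C s|) * (t ^ (m + 1) * |Real.log t| ^ M) := by gcongr
    _ = _ := by ring

lemma IsFormalSolution.coeff_truncFam {φ : Tan d → Fin p → ℝ} {c : ℕ → ℕ → Tan d → Fin p → ℝ}
    (h : IsFormalSolution r φ c) {y : Tan d} (hy : y ∈ Metric.ball 0 r) (s : Fin p) {i k : ℕ}
    (hi : i < k) : PowerSeries.coeff i (clearedSeries (truncFam k c) y s) = 0 := by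
  rw [← h.coeff_eq_zero hy s i]
  refine (coeff_clearedSeries_congr (agreeBelow_truncFam k c) h.one ?_ hy
    (Nat.succ_lt_succ hi) s).symm
  intro z hz
  rw [truncFam, if_pos (by omega)]
  exact h.one hz

lemma IsFormalSolution.isBigOLoc_low {φ : Tan d → Fin p → ℝ} {c : ℕ → ℕ → Tan d → Fin p → ℝ}
    (h : IsFormalSolution r φ c) {k : ℕ} (hk : k ≤ d + 1) :
    IsBigOLoc r (Q (partialSum c k)) (fun t => t ^ (2 * (k / 2))) := by
  have := isBigOLoc_partialSum h.smoothCoef k (2 * (k / 2)) 0 ?_ ?_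
  · simpa using this
  · intro y hy s i hi
    by_cases hik : i < k
    · exact h.coeff_truncFam hy s hik
    · exact coeff_clearedSeries_of_even
        (evenFam_truncFam hk fun i hi ho => h.odd_eq_zero i (hi.trans hk) ho) hy s
        ⟨k / 2, by omega⟩
  · -- no logarithms occur up to order `n`, so `N` may be taken arbitrarily large
    intro y hy s j hj
    have hB : ∀ s, LogBound r (2 * (k / 2) + 2) (comp (truncFam k c) s) := by
      intro s i j hj hij z _
      have hi : ¬ i ≤ k := by
        intro hi
        rw [logDeg_of_le (hi.trans hk), Nat.le_zero] at hj
        subst hj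
        simp at hij
      simp [comp, truncFam, hi]
    refine clearedSeries_mem_logSubring hB hy s _ _ ?_
    exact lt_of_lt_of_le (by omega) (Nat.le_mul_of_pos_right _ hj)

lemma IsFormalSolution.isBigOLoc_high {φ : Tan d → Fin p → ℝ} {c : ℕ → ℕ → Tan d → Fin p → ℝ}
    (h : IsFormalSolution r φ c) {k : ℕ} (hk : 1 ≤ k) :
    IsBigOLoc r (Q (partialSum c k))
      (fun t => t ^ (k - 1) * |Real.log t| ^ (k / (d + 1))) := by
  obtain ⟨m, rfl⟩ : ∃ m, k = m + 1 := ⟨k - 1, by omega⟩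
  rw [Nat.add_sub_cancel]
  refine isBigOLoc_partialSum h.smoothCoef (m + 1) m _ (fun y hy s i hi => ?_)
    (fun y hy s j hj => ?_)
  · exact h.coeff_truncFam hy s hi
  · refine clearedSeries_mem_logSubring (fun s => logBound_self _) hy s _ _ ?_
    rw [mul_comm]
    exact (Nat.div_lt_iff_lt_mul (Nat.succ_pos d)).1 hj

end MinSys

theorem lemma5p4 (d p : ℕ) (r : ℝ) (hr : 0 < r)
    (φ : MinSys.Tan d → Fin p → ℝ) (hφ : ContDiffOn ℝ ∞ φ (Metric.ball 0 r))
    (b : MinSys.Tan d → Fin p → ℝ) (hb : ContDiffOn ℝ ∞ b (Metric.ball 0 r)) :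
    ∃ c : ℕ → ℕ → MinSys.Tan d → Fin p → ℝ,
      (MinSys.IsFormalSolution r φ c ∧ Set.EqOn (c (d + 2) 0) b (Metric.ball 0 r)) ∧
      (∀ c' : ℕ → ℕ → MinSys.Tan d → Fin p → ℝ,
        MinSys.IsFormalSolution r φ c' → Set.EqOn (c' (d + 2) 0) b (Metric.ball 0 r) →
        ∀ i, ∀ j ≤ MinSys.logDeg d i, Set.EqOn (c' i j) (c i j) (Metric.ball 0 r)) ∧
      (∀ i ≤ d + 1, Odd i → Set.EqOn (c i 0) 0 (Metric.ball 0 r)) ∧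
      (∀ k ≤ d + 1, MinSys.IsBigOLoc r (MinSys.Q (MinSys.partialSum c k))
        (fun t => t ^ (2 * (k / 2)))) ∧
      (∀ k ≥ d + 2, MinSys.IsBigOLoc r (MinSys.Q (MinSys.partialSum c k))
        (fun t => t ^ (k - 1) * |Real.log t| ^ (k / (d + 1)))) := by
  obtain ⟨c, hc, hcb⟩ := MinSys.exists_isFormalSolution φ b hφ hb
  refine ⟨c, ⟨hc, hcb⟩, fun c' hc' hcb' i j hj y hy => ?_, hc.odd_eq_zero,
    fun k hk => hc.isBigOLoc_low hk, fun k hk => hc.isBigOLoc_high (by omega)⟩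
  funext s
  exact hc.agreeBelow hc' (hcb'.trans hcb.symm) (i + 1) s i (Nat.lt_succ_self i) j hj hy
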